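/- There are an algorithm and constants $C,c\in\mathbb N$ such that the following holds. Let $G$ be a simple undirected graph with $k$ vertices, and let $S$ be a family (a set) of subsets of $E(G)$. Given $G$ and $S$ (as adjacency matrices, the members of $S$ being listed in any order without repetition), the algorithm computes, in time at most $C\,(k+1)^{c}\cdot\max(1,|S|)\cdot 12^{k}$, i.e. in time $k^{O(1)}\,|S|\,12^{k}$, a subfamily $\hat S\subseteq S$ with $|\hat S|\le 6^{k}$ such that for every set $Y\subseteq E(G)$: if there exists $s\in S$ disjoint from $Y$ such that $s\cup Y$ is (the edge set of) a Hamiltonian cycle of $G$, then there exists $\hat s\in\hat S$ disjoint from $Y$ such that $\hat s\cup Y$ is a Hamiltonian cycle of $G$. Here a Hamiltonian cycle of $G$ is a simple cycle of $G$ (hence of length at least $3$) through all $k$ vertices, and time is measured on a random access machine with logarithmic cost. -/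

import Mathlib

/-! ### Random access machines with logarithmic cost

A program is a while-program over natural-number registers and natural-number arrays. A program
is a fixed finite object, so it mentions only finitely many registers and arrays. Every operation
is charged the bit length of the numbers it handles (array indices included), so that no work can
be hidden in long numbers. -/

namespace RAM

/-- Arithmetic operations on natural numbers (`sub` is truncated; `x / 0 = 0`, `x % 0 = x`). -/
inductive Op where
  | add
  | sub
  | mul
  | div
  | mod

/-- The value of an arithmetic operation. -/
def Op.eval : Op → ℕ → ℕ → ℕ
  | .add, x, y => x + y
  | .sub, x, y => x - y
  | .mul, x, y => x * y
  | .div, x, y => x / y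
  | .mod, x, y => x % y

/-- Memory contents: register `r` holds `reg r`, cell `i` of array `a` holds `arr a i`. -/
structure State where
  reg : ℕ → ℕ
  arr : ℕ → ℕ → ℕ

/-- Expressions: constants, registers, array cells, arithmetic. -/
inductive Expr where
  | const (c : ℕ)
  | reg (r : ℕ)
  | cell (a : ℕ) (i : Expr)
  | bin (o : Op) (e f : Expr)

/-- The value of an expression. -/
def Expr.eval (σ : State) : Expr → ℕ
  | .const c => c
  | .reg r => σ.reg r
  | .cell a i => σ.arr a (i.eval σ)
  | .bin o e f => o.eval (e.eval σ) (f.eval σ)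

/-- The cost of evaluating an expression: every node of the expression is charged one plus the
bit length of its value. -/
def Expr.cost (σ : State) : Expr → ℕ
  | .const c => 1 + Nat.size c
  | .reg r => 1 + Nat.size (σ.reg r)
  | .cell a i => i.cost σ + (1 + Nat.size (σ.arr a (i.eval σ)))
  | .bin o e f => e.cost σ + f.cost σ + (1 + Nat.size (o.eval (e.eval σ) (f.eval σ)))

/-- Programs. The conditions of `ite` and `loop` mean "the value is not `0`". -/
inductive Prog where
  | skip
  | assign (r : ℕ) (e : Expr)
  | write (a : ℕ) (i e : Expr)
  | seq (p q : Prog)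
  | ite (e : Expr) (p q : Prog)
  | loop (e : Expr) (p : Prog)

/-- `Run p σ t τ`: the program `p`, started in the state `σ`, halts in the state `τ`, at total
cost `t`. -/
inductive Run : Prog → State → ℕ → State → Prop where
  | skip (σ : State) : Run .skip σ 1 σ
  | assign (σ : State) (r : ℕ) (e : Expr) :
      Run (.assign r e) σ (1 + e.cost σ)
        { reg := Function.update σ.reg r (e.eval σ), arr := σ.arr }
  | write (σ : State) (a : ℕ) (i e : Expr) :
      Run (.write a i e) σ (1 + i.cost σ + e.cost σ)
        { reg := σ.reg
          arr := Function.update σ.arr a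
            (Function.update (σ.arr a) (i.eval σ) (e.eval σ)) }
  | seq {p q : Prog} {σ τ ρ : State} {t u : ℕ} :
      Run p σ t τ → Run q τ u ρ → Run (.seq p q) σ (t + u) ρ
  | iteTrue {e : Expr} {p : Prog} (q : Prog) {σ τ : State} {t : ℕ} :
      e.eval σ ≠ 0 → Run p σ t τ → Run (.ite e p q) σ (1 + e.cost σ + t) τ
  | iteFalse {e : Expr} (p : Prog) {q : Prog} {σ τ : State} {t : ℕ} :
      e.eval σ = 0 → Run q σ t τ → Run (.ite e p q) σ (1 + e.cost σ + t) τ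
  | loopDone {e : Expr} (p : Prog) {σ : State} :
      e.eval σ = 0 → Run (.loop e p) σ (1 + e.cost σ) σ
  | loopStep {e : Expr} {p : Prog} {σ τ ρ : State} {t u : ℕ} :
      e.eval σ ≠ 0 → Run p σ t τ → Run (.loop e p) τ u ρ →
        Run (.loop e p) σ (1 + e.cost σ + t + u) ρ

/-- The machine is deterministic: the cost and the final state depend only on the program and the
initial state. -/
theorem Run.deterministic {p : Prog} {σ τ τ' : State} {t t' : ℕ}
    (h : Run p σ t τ) (h' : Run p σ t' τ') : t = t' ∧ τ = τ' := by
  induction h generalizing t' τ' with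
  | skip => cases h'; exact ⟨rfl, rfl⟩
  | assign => cases h'; exact ⟨rfl, rfl⟩
  | write => cases h'; exact ⟨rfl, rfl⟩
  | seq _ _ ih₁ ih₂ =>
    cases h' with
    | seq h₁ h₂ =>
      obtain ⟨rfl, rfl⟩ := ih₁ h₁
      obtain ⟨rfl, rfl⟩ := ih₂ h₂
      exact ⟨rfl, rfl⟩
  | iteTrue _ he _ ih =>
    cases h' with
    | iteTrue _ _ h₁ => obtain ⟨rfl, rfl⟩ := ih h₁; exact ⟨rfl, rfl⟩
    | iteFalse _ he' _ => exact absurd he' he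
  | iteFalse _ he _ ih =>
    cases h' with
    | iteTrue _ he' _ => exact absurd he he'
    | iteFalse _ _ h₁ => obtain ⟨rfl, rfl⟩ := ih h₁; exact ⟨rfl, rfl⟩
  | loopDone _ he =>
    cases h' with
    | loopDone => exact ⟨rfl, rfl⟩
    | loopStep he' _ _ => exact absurd he he'
  | loopStep he _ _ ih₁ ih₂ =>
    cases h' with
    | loopDone _ he' => exact absurd he' he
    | loopStep _ h₁ h₂ =>
      obtain ⟨rfl, rfl⟩ := ih₁ h₁
      obtain ⟨rfl, rfl⟩ := ih₂ h₂
      exact ⟨rfl, rfl⟩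

end RAM

/-! ### Hamiltonian cycles as edge sets -/

/-- The edge set `H` forms a Hamiltonian cycle of `G`: it is the set of edges of a simple cycle
of `G` through all vertices. -/
def FormsHamiltonianCycle {k : ℕ} (G : SimpleGraph (Fin k)) (H : Finset (Sym2 (Fin k))) : Prop :=
  ∃ (a : Fin k) (w : G.Walk a a), w.IsHamiltonianCycle ∧ w.edges.toFinset = H

/-! ### Input and output

Vertices are the numbers `0, …, k - 1`; a graph is given by its `k × k` adjacency matrix, stored
row by row; a family of edge sets is given by listing its members in some order, without
repetition, each as the adjacency matrix of the edge set. -/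

/-- The adjacency matrix of `G`, stored row by row, followed by zeros. -/
noncomputable def graphArray {k : ℕ} (G : SimpleGraph (Fin k)) : ℕ → ℕ :=
  open Classical in
  fun x => if ∃ u v : Fin k, x = u.val * k + v.val ∧ G.Adj u v then 1 else 0

/-- The concatenated adjacency matrices of the edge sets in the list `L`, followed by zeros. -/
noncomputable def familyArray {k : ℕ} (L : List (Finset (Sym2 (Fin k)))) : ℕ → ℕ :=
  open Classical in
  fun x => if ∃ (i : Fin L.length) (u v : Fin k),
    x = (i.val * k + u.val) * k + v.val ∧ s(u, v) ∈ L.get i then 1 else 0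

/-- The list `L` lists the family `S`, in some order and without repetition. -/
def IsListing {k : ℕ} (L : List (Finset (Sym2 (Fin k)))) (S : Finset (Finset (Sym2 (Fin k)))) : Prop :=
  L.Nodup ∧ L.toFinset = S

/-- The initial state on input `G` and `L`: register `0` holds the number of vertices, register
`1` the number of edge sets, array `0` the graph, array `1` the edge sets; all else is `0`. -/
noncomputable def inputState {k : ℕ} (G : SimpleGraph (Fin k))
    (L : List (Finset (Sym2 (Fin k)))) : RAM.State where
  reg := fun r => if r = 0 then k else if r = 1 then L.length else 0
  arr := fun a => if a = 0 then graphArray G else if a = 1 then familyArray L else fun _ => 0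

/-- The state `τ` outputs the family `T`: register `0` holds the number of members of `T`, and
array `2` begins with the adjacency matrices of the members of `T`, in some order and without
repetition. -/
def Outputs {k : ℕ} (τ : RAM.State) (T : Finset (Finset (Sym2 (Fin k)))) : Prop :=
  ∃ L : List (Finset (Sym2 (Fin k))), IsListing L T ∧ τ.reg 0 = L.length ∧
    ∀ x < L.length * k * k, τ.arr 2 x = familyArray L x

namespace RAM

/-! ### Symbolic execution with cost bounds -/

/-! Give every edge set `s` with all degrees at most 2 a cut vector over the field with two
elements. It has one entry for each vertex set containing vertex 0, equal to 1 when no edge of `s`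
leaves that vertex set. The inner product of the cut vectors of `s` and `Y` counts the vertex sets
respected by `s ∪ Y`. With `c` components there are `2 ^ (c - 1)` of them, so the product is odd
exactly when `s ∪ Y` is connected (`pairing_cutValue`, `card_respectedCuts_of_preconnected`,
`even_card_respectedCuts`).

Group the edge sets by their degree sequences and keep, in each group, edge sets whose cut vectors
form a basis of the span. If `s` is disjoint from `Y` and `s ∪ Y` is a Hamiltonian cycle, the
product for `s` is odd. The cut vector of `s` is a sum of kept vectors of its group, so the product
is odd for some kept `t` with the degrees of `s`. Then `t ∪ Y` is connected and the degrees of `t`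
and `Y` add up to 2 everywhere, which forces disjointness and a Hamiltonian cycle
(`formsHamiltonianCycle_exchange`, `exists_mem_of_dvd`). There are `3 ^ k` degree codes and each
basis has at most `2 ^ k` members, hence the bound `6 ^ k`.

The bases are maintained online in echelon form. Up to polynomial factors, one edge set costs `2 ^
k` pivots times `2 ^ k` entries, and `4 ^ k ≤ 12 ^ k` (`exec_stepProg`, `totalTime_le`). Stored
numbers have `O(k ^ 2)` bits, so logarithmic cost adds only a polynomial factor. `Exec` combines
result, time, word length and untouched memory in one assertion. -/

/-- The state with register `r` set to `x`. -/
def State.setReg (σ : State) (r x : ℕ) : State :=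
  { reg := Function.update σ.reg r x, arr := σ.arr }

/-- The state with cell `i` of array `a` set to `x`. -/
def State.setCell (σ : State) (a i x : ℕ) : State :=
  { reg := σ.reg
    arr := Function.update σ.arr a (Function.update (σ.arr a) i x) }

@[simp] theorem State.setReg_reg (σ : State) (r x r' : ℕ) :
    (σ.setReg r x).reg r' = if r' = r then x else σ.reg r' := by
  simp [State.setReg, Function.update_apply]

@[simp] theorem State.setReg_arr (σ : State) (r x : ℕ) : (σ.setReg r x).arr = σ.arr := rfl

theorem State.setCell_arr (σ : State) (a i x a' j : ℕ) :
    (σ.setCell a i x).arr a' j = if a' = a ∧ j = i then x else σ.arr a' j := by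
  by_cases h : a' = a
  · subst h; simp [State.setCell, Function.update_apply]
  · simp [State.setCell, h]

@[simp] theorem State.setCell_arr_self (σ : State) (a i x j : ℕ) :
    (σ.setCell a i x).arr a j = if j = i then x else σ.arr a j := by
  simp [State.setCell_arr]

theorem State.setCell_arr_ne (σ : State) {a a' : ℕ} (i x : ℕ) (h : a' ≠ a) :
    (σ.setCell a i x).arr a' = σ.arr a' := by
  simp [State.setCell, h]

/-! ### Word length and cost of expressions. -/

/-- All numbers in the memory have at most `W` bits. -/
structure Bounded (W : ℕ) (σ : State) : Prop where
  reg : ∀ r, (σ.reg r).size ≤ W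
  arr : ∀ a i, (σ.arr a i).size ≤ W

theorem Bounded.setReg {W : ℕ} {σ : State} (h : Bounded W σ) (r : ℕ) {x : ℕ} (hx : x.size ≤ W) :
    Bounded W (σ.setReg r x) where
  reg r' := by
    rw [State.setReg_reg]; split_ifs
    exacts [hx, h.reg r']
  arr := h.arr

theorem Bounded.setCell {W : ℕ} {σ : State} (h : Bounded W σ) (a i : ℕ) {x : ℕ}
    (hx : x.size ≤ W) : Bounded W (σ.setCell a i x) where
  reg := h.reg
  arr a' j := by
    rw [State.setCell_arr]; split_ifs
    exacts [hx, h.arr a' j]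

/-- A bound on the bit length of the value of an expression, in units of `W + 1`. -/
def Expr.bits : Expr → ℕ
  | .const c => c
  | .reg _ => 1
  | .cell _ _ => 1
  | .bin _ e f => e.bits + f.bits + 1

/-- A bound on the cost of an expression, in units of `W + 1`. -/
def Expr.weight : Expr → ℕ
  | .const c => 1 + c
  | .reg _ => 1
  | .cell _ i => i.weight + 1
  | .bin o e f => e.weight + f.weight + (1 + (Expr.bin o e f).bits)

/-- Sums and products are below twice the product of the two bounding powers of two; the other
operations never exceed `x`. Bit lengths thus grow additively along an expression. -/
theorem Op.size_eval_le (o : Op) (x y : ℕ) : (o.eval x y).size ≤ x.size + y.size + 1 := by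
  have hx := Nat.lt_size_self x
  have hy := Nat.lt_size_self y
  have h1 : 1 ≤ 2 ^ x.size := Nat.one_le_two_pow
  have h2 : 1 ≤ 2 ^ y.size := Nat.one_le_two_pow
  have hle : ∀ z ≤ x, z.size ≤ x.size + y.size + 1 := fun z hz =>
    (Nat.size_le_size hz).trans (by omega)
  cases o with
  | add =>
    rw [Nat.size_le, pow_succ, pow_add]
    show x + y < _
    nlinarith
  | sub => exact hle _ (Nat.sub_le _ _)
  | mul =>
    rw [Nat.size_le, pow_succ, pow_add]
    show x * y < _
    have : x * y < 2 ^ x.size * 2 ^ y.size := Nat.mul_lt_mul'' hx hy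
    omega
  | div => exact hle _ (Nat.div_le_self _ _)
  | mod => exact hle _ (Nat.mod_le _ _)

theorem Expr.size_eval_le {W : ℕ} {σ : State} (h : Bounded W σ) :
    ∀ e : Expr, (e.eval σ).size ≤ e.bits * (W + 1)
  -- A constant is charged its value in place of its bit length, a crude bound that `decide` can
  -- evaluate.
  | .const c => (Nat.size_le.2 Nat.lt_two_pow_self).trans
      (Nat.le_mul_of_pos_right _ (Nat.succ_pos W))
  | .reg r => (h.reg r).trans (by simp [Expr.bits])
  | .cell a i => (h.arr a _).trans (by simp [Expr.bits])
  | .bin o e f => by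
    have he := Expr.size_eval_le h e
    have hf := Expr.size_eval_le h f
    have := o.size_eval_le (e.eval σ) (f.eval σ)
    simp only [Expr.bits, Expr.eval]
    nlinarith

theorem Expr.cost_le {W : ℕ} {σ : State} (h : Bounded W σ) :
    ∀ e : Expr, e.cost σ ≤ e.weight * (W + 1)
  | .const c => (Nat.add_le_add_left (Nat.size_le.2 Nat.lt_two_pow_self) 1).trans
      (Nat.le_mul_of_pos_right _ (Nat.succ_pos W))
  | .reg r => by
    have := h.reg r
    simp only [Expr.cost, Expr.weight]; omega
  | .cell a i => by
    have hi := Expr.cost_le h i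
    have := h.arr a (i.eval σ)
    simp only [Expr.cost, Expr.weight]; nlinarith
  | .bin o e f => by
    have he := Expr.cost_le h e
    have hf := Expr.cost_le h f
    have := Expr.size_eval_le h (.bin o e f)
    simp only [Expr.cost, Expr.weight, Expr.eval] at this ⊢
    nlinarith

instance : Add Expr := ⟨.bin .add⟩
instance : Sub Expr := ⟨.bin .sub⟩
instance : Mul Expr := ⟨.bin .mul⟩
instance : Div Expr := ⟨.bin .div⟩
instance : Mod Expr := ⟨.bin .mod⟩

section eval

variable (σ : State) (e f : Expr)

@[simp] theorem Expr.eval_const (c : ℕ) : (Expr.const c).eval σ = c := rfl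
@[simp] theorem Expr.eval_reg (r : ℕ) : (Expr.reg r).eval σ = σ.reg r := rfl
@[simp] theorem Expr.eval_cell (a : ℕ) : (Expr.cell a e).eval σ = σ.arr a (e.eval σ) := rfl
@[simp] theorem Expr.eval_add : (e + f).eval σ = e.eval σ + f.eval σ := rfl
@[simp] theorem Expr.eval_sub : (e - f).eval σ = e.eval σ - f.eval σ := rfl
@[simp] theorem Expr.eval_mul : (e * f).eval σ = e.eval σ * f.eval σ := rfl
@[simp] theorem Expr.eval_div : (e / f).eval σ = e.eval σ / f.eval σ := rfl
@[simp] theorem Expr.eval_mod : (e % f).eval σ = e.eval σ % f.eval σ := rfl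

end eval

/-! ### Frame conditions and rules for timed execution. -/

/-- The registers that a program writes to. -/
def Prog.regs : Prog → List ℕ
  | .skip => []
  | .assign r _ => [r]
  | .write _ _ _ => []
  | .seq p q => p.regs ++ q.regs
  | .ite _ p q => p.regs ++ q.regs
  | .loop _ p => p.regs

/-- The arrays that a program writes to. -/
def Prog.arrs : Prog → List ℕ
  | .skip => []
  | .assign _ _ => []
  | .write a _ _ => [a]
  | .seq p q => p.arrs ++ q.arrs
  | .ite _ p q => p.arrs ++ q.arrs
  | .loop _ p => p.arrs

/-- The two states agree outside the registers `R` and the arrays `A`. -/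
structure Agree (R A : List ℕ) (σ τ : State) : Prop where
  reg : ∀ r ∉ R, τ.reg r = σ.reg r
  arr : ∀ a ∉ A, τ.arr a = σ.arr a

theorem Agree.refl (R A : List ℕ) (σ : State) : Agree R A σ σ := ⟨fun _ _ => rfl, fun _ _ => rfl⟩

theorem Agree.trans {R A R' A' R'' A'' : List ℕ} {σ τ ρ : State} (h : Agree R A σ τ)
    (h' : Agree R' A' τ ρ) (hR : R ⊆ R'') (hR' : R' ⊆ R'') (hA : A ⊆ A'') (hA' : A' ⊆ A'') :
    Agree R'' A'' σ ρ where
  reg r hr := (h'.reg r fun h => hr (hR' h)).trans (h.reg r fun h => hr (hR h))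
  arr a ha := (h'.arr a fun h => ha (hA' h)).trans (h.arr a fun h => ha (hA h))

theorem Agree.mono {R A R' A' : List ℕ} {σ τ : State} (h : Agree R A σ τ)
    (hR : R ⊆ R') (hA : A ⊆ A') : Agree R' A' σ τ :=
  h.trans (Agree.refl R A τ) hR hR hA hA

theorem Agree.setReg (σ : State) (r x : ℕ) : Agree [r] [] σ (σ.setReg r x) where
  reg r' hr := by
    rw [State.setReg_reg, if_neg (by simpa using hr)]
  arr _ _ := rfl

theorem Agree.setCell (σ : State) (a i x : ℕ) : Agree [] [a] σ (σ.setCell a i x) where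
  reg _ _ := rfl
  arr a' ha := State.setCell_arr_ne σ i x (by simpa using ha)

/-- Started in a state `σ` with numbers of at most `W` bits, the program `p` halts at cost at most
`n * (W + 1)` in such a state, which satisfies `Q`. -/
def Exec (W n : ℕ) (p : Prog) (σ : State) (Q : State → Prop) : Prop :=
  Bounded W σ → ∃ t τ, Run p σ t τ ∧ t ≤ n * (W + 1) ∧ Bounded W τ ∧
    Agree p.regs p.arrs σ τ ∧ Q τ

theorem Exec.mono {W n n' : ℕ} {p : Prog} {σ : State} {Q Q' : State → Prop} (h : Exec W n p σ Q)
    (hn : n ≤ n') (hQ : ∀ τ, Agree p.regs p.arrs σ τ → Q τ → Q' τ) : Exec W n' p σ Q' := by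
  intro hσ
  obtain ⟨t, τ, hr, ht, hb, ha, hq⟩ := h hσ
  exact ⟨t, τ, hr, ht.trans (Nat.mul_le_mul_right _ hn), hb, ha, hQ τ ha hq⟩

theorem Exec.skip {W n : ℕ} {σ : State} {Q : State → Prop} (h : Q σ) (hn : 1 ≤ n := by decide) :
    Exec W n .skip σ Q :=
  fun hσ => ⟨1, σ, .skip σ, by nlinarith, hσ, Agree.refl _ _ _, h⟩

theorem Exec.assign {W n : ℕ} {r : ℕ} {e : Expr} {σ : State} {Q : State → Prop}
    (hW : Bounded W σ → (e.eval σ).size ≤ W) (h : Q (σ.setReg r (e.eval σ)))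
    (hn : 1 + e.weight ≤ n := by decide) : Exec W n (.assign r e) σ Q := by
  intro hσ
  refine ⟨_, _, .assign σ r e, ?_, hσ.setReg r (hW hσ), Agree.setReg _ _ _, h⟩
  have := e.cost_le hσ
  nlinarith

theorem Exec.write {W n : ℕ} {a : ℕ} {i e : Expr} {σ : State} {Q : State → Prop}
    (hW : Bounded W σ → (e.eval σ).size ≤ W) (h : Q (σ.setCell a (i.eval σ) (e.eval σ)))
    (hn : 1 + i.weight + e.weight ≤ n := by decide) : Exec W n (.write a i e) σ Q := by
  intro hσ
  refine ⟨_, _, .write σ a i e, ?_, hσ.setCell a _ (hW hσ), Agree.setCell _ _ _ _, h⟩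
  have := e.cost_le hσ
  have := i.cost_le hσ
  nlinarith

theorem Exec.seq {W l : ℕ} {p q : Prog} {σ : State} {Q : State → Prop} (n m : ℕ)
    (R : State → Prop) (hp : Exec W n p σ R)
    (hq : ∀ τ, Agree p.regs p.arrs σ τ → R τ → Exec W m q τ Q) (hl : n + m ≤ l) :
    Exec W l (.seq p q) σ Q := by
  intro hσ
  obtain ⟨t, τ, hr, ht, hb, ha, h⟩ := hp hσ
  obtain ⟨t', ρ, hr', ht', hb', ha', h'⟩ := hq τ ha h hb
  refine ⟨_, ρ, .seq hr hr', ?_, hb', ?_, h'⟩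
  · exact (Nat.add_le_add ht ht').trans (by rw [← add_mul]; exact Nat.mul_le_mul_right _ hl)
  · exact ha.trans ha' (List.subset_append_left _ _) (List.subset_append_right _ _)
      (List.subset_append_left _ _) (List.subset_append_right _ _)

theorem Exec.ite {W l : ℕ} {e : Expr} {p q : Prog} {σ : State} {Q : State → Prop} (n : ℕ)
    (hp : e.eval σ ≠ 0 → Exec W n p σ Q) (hq : e.eval σ = 0 → Exec W n q σ Q)
    (hl : 1 + e.weight + n ≤ l) : Exec W l (.ite e p q) σ Q := by
  intro hσ
  have hc := e.cost_le hσ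
  by_cases he : e.eval σ = 0
  · obtain ⟨t, τ, hr, ht, hb, ha, h⟩ := hq he hσ
    refine ⟨_, τ, .iteFalse p he hr, by nlinarith, hb, ?_, h⟩
    exact ha.mono (List.subset_append_right _ _) (List.subset_append_right _ _)
  · obtain ⟨t, τ, hr, ht, hb, ha, h⟩ := hp he hσ
    refine ⟨_, τ, .iteTrue q he hr, by nlinarith, hb, ?_, h⟩
    exact ha.mono (List.subset_append_left _ _) (List.subset_append_left _ _)

/-- Run `p` for the values `0, 1, …, e - 1` of the register `r`. -/
def Prog.forLoop (r : ℕ) (e : Expr) (p : Prog) : Prog :=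
  .seq (.assign r (.const 0))
    (.loop (.bin .sub e (.reg r)) (.seq p (.assign r (.bin .add (.reg r) (.const 1)))))

/-- The bound `e` is evaluated anew before every round, so its value must survive all changes that
the loop can make. -/
theorem Exec.forLoop {W l r : ℕ} {e : Expr} {p : Prog} {σ : State} (n N : ℕ)
    (I : ℕ → State → Prop)
    (hr : r ∉ p.regs)
    (he : ∀ τ, Agree (r :: p.regs) p.arrs σ τ → e.eval τ = N) (hN : N.size ≤ W)
    (h0 : I 0 (σ.setReg r 0))
    (hs : ∀ j < N, ∀ τ, Agree (r :: p.regs) p.arrs σ τ → τ.reg r = j → I j τ →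
      Exec W n p τ fun ρ => I (j + 1) (ρ.setReg r (j + 1)))
    (hl : (N + 1) * (n + (2 * e.weight + e.bits + 20)) ≤ l) :
    Exec W l (.forLoop r e p) σ (I N) := by
  intro hσ
  -- Induction on the number `l` of remaining rounds. The overhead 15 per round, against 20 in the
  -- statement, leaves room for the initial assignment.
  have key : ∀ l j, j + l = N → ∀ τ, Agree (r :: p.regs) p.arrs σ τ → τ.reg r = j → I j τ →
      Bounded W τ → ∃ t ρ,
        Run (.loop (.bin .sub e (.reg r)) (.seq p (.assign r (.bin .add (.reg r) (.const 1)))))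
          τ t ρ ∧ t ≤ ((l + 1) * (n + (2 * e.weight + e.bits + 15))) * (W + 1) ∧ Bounded W ρ ∧
        Agree (r :: p.regs) p.arrs σ ρ ∧ I N ρ := by
    intro l
    induction l with
    | zero =>
      intro j hj τ ha hrj hI hb
      have hev : (Expr.bin .sub e (.reg r)).eval τ = 0 := by
        simp only [Expr.eval, Op.eval, he τ ha, hrj]; omega
      refine ⟨_, τ, .loopDone _ hev, ?_, hb, ha, by simpa [← hj] using hI⟩
      have := (Expr.bin .sub e (.reg r)).cost_le hb
      simp only [Expr.weight, Expr.bits] at this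
      nlinarith
    | succ l ih =>
      intro j hj τ ha hrj hI hb
      have hev : (Expr.bin .sub e (.reg r)).eval τ ≠ 0 := by
        simp only [Expr.eval, Op.eval, he τ ha, hrj]; omega
      obtain ⟨t, ρ, hrun, ht, hb', ha', hI'⟩ := hs j (by omega) τ ha hrj hI hb
      have hrρ : ρ.reg r = j := by rw [ha'.reg r hr, hrj]
      have ha₁ : Agree (r :: p.regs) p.arrs σ ρ :=
        ha.trans ha' (List.Subset.refl _) (List.subset_cons_self _ _) (List.Subset.refl _)
          (List.Subset.refl _)
      have ha₂ : Agree (r :: p.regs) p.arrs σ (ρ.setReg r (j + 1)) :=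
        ha₁.trans (Agree.setReg ρ r (j + 1)) (List.Subset.refl _) (by simp) (List.Subset.refl _)
          (by simp)
      have hrun' := Run.assign ρ r (.bin .add (.reg r) (.const 1))
      have hst : State.mk (Function.update ρ.reg r
          ((Expr.bin .add (.reg r) (.const 1)).eval ρ)) ρ.arr = ρ.setReg r (j + 1) := by
        simp [State.setReg, Expr.eval, Op.eval, hrρ]
      rw [hst] at hrun'
      obtain ⟨t', ρ', hrun₂, ht', hb₂, ha₃, hI₂⟩ := ih (j + 1) (by omega) _ ha₂ (by simp) hI'
        (hb'.setReg r ((Nat.size_le_size (by omega : j + 1 ≤ N)).trans hN))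
      refine ⟨_, ρ', .loopStep hev (.seq hrun hrun') hrun₂, ?_, hb₂, ha₃, hI₂⟩
      have c₁ := (Expr.bin .sub e (.reg r)).cost_le hb
      have c₂ := (Expr.bin .add (.reg r) (.const 1)).cost_le hb'
      simp only [Expr.weight, Expr.bits] at c₁ c₂
      nlinarith
  obtain ⟨t, ρ, hrun, ht, hb, ha, hI⟩ := key N 0 (by omega) (σ.setReg r 0)
    ((Agree.setReg σ r 0).mono (by simp) (by simp)) (by simp) h0 (hσ.setReg r (by simp))
  refine ⟨_, ρ, .seq (.assign σ r (.const 0)) hrun, ?_, hb, ?_, hI⟩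
  · refine le_trans ?_ (Nat.mul_le_mul_right _ hl)
    simp only [Expr.cost, Nat.size_zero]
    nlinarith
  · refine ha.mono ?_ ?_
    · simp [Prog.forLoop, Prog.regs]
    · simp [Prog.forLoop, Prog.arrs]

end RAM

open RAM

/-! ### The algorithm

Registers: `0` number `k` of vertices, `1` number of edge sets, `2` current edge set, `3` number of
selected edge sets, `4` degree code, `5` the number `2 ^ k`, `6` whether all degrees are at most
`2`, `7` and `8` vertices, `9` degree, `10` cut, `11` pair of vertices, `12` entry of the cut
vector, `13` pivot, `14` whether the current edge set is selected.

Arrays: `1` the edge sets, `2` the selected edge sets, `3` the current vector, `4` the basis,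
`5` the powers of two. -/

namespace RepresentativeFamily

open RAM.Prog

/-- The powers of two. -/
def powersProg : Prog :=
  .seq (.assign 5 (.const 1))
    (forLoop 7 (.reg 0) (.seq (.write 5 (.reg 7) (.reg 5)) (.assign 5 (.reg 5 * .const 2))))

/-- The degree of the vertex in register `7`. -/
def degreeProg : Prog :=
  .seq (.assign 9 (.const 0))
    (forLoop 8 (.reg 0)
      (.assign 9 (.reg 9 + .cell 1 ((.reg 2 * .reg 0 + .reg 7) * .reg 0 + .reg 8))))

/-- The degree code and the degree test. -/
def profileProg : Prog :=
  .seq (.assign 4 (.const 0)) <| .seq (.assign 6 (.const 1))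
    (forLoop 7 (.reg 0)
      (.seq degreeProg
        (.seq (.assign 4 (.const 3 * .reg 4 + .reg 9 % .const 3))
          (.assign 6 (.reg 6 * (.const 1 - .reg 9 / .const 3))))))

/-- Whether the cut in register `10` is respected. -/
def cutProg : Prog :=
  .seq (.assign 12 (.reg 6 * (.reg 10 % .const 2)))
    (forLoop 11 (.reg 0 * .reg 0)
      (.assign 12 (.reg 12 * (.const 1 - .cell 1 (.reg 2 * (.reg 0 * .reg 0) + .reg 11) *
        ((.reg 10 / .cell 5 (.reg 11 / .reg 0) + .reg 10 / .cell 5 (.reg 11 % .reg 0)) %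
          .const 2)))))

/-- The vector of all cuts. -/
def vectorProg : Prog :=
  forLoop 10 (.reg 5) (.seq cutProg (.write 3 (.reg 10) (.reg 12)))

/-- Store the current vector in the basis. -/
def storeProg : Prog :=
  .seq
    (forLoop 10 (.reg 5)
      (.write 4 ((.reg 4 * .reg 5 + .reg 13) * .reg 5 + .reg 10) (.cell 3 (.reg 10))))
    (.assign 14 (.const 1))

/-- Add a basis vector to the current vector. -/
def addProg : Prog :=
  forLoop 10 (.reg 5)
    (.write 3 (.reg 10) ((.cell 3 (.reg 10) +
      .cell 4 ((.reg 4 * .reg 5 + .reg 13) * .reg 5 + .reg 10)) % .const 2))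

/-- Reduce the current vector by one pivot. -/
def pivotProg : Prog :=
  .ite (.cell 3 (.reg 13))
    (.seq
      (.ite (.cell 4 ((.reg 4 * .reg 5 + .reg 13) * .reg 5 + .reg 13)) .skip storeProg)
      addProg)
    .skip

/-- Reduce the current vector by all pivots. -/
def reduceProg : Prog :=
  .seq (.assign 14 (.const 0)) (forLoop 13 (.reg 5) pivotProg)

/-- Copy the current edge set behind the selected ones. -/
def copyProg : Prog :=
  forLoop 11 (.reg 0 * .reg 0)
    (.write 2 (.reg 3 * (.reg 0 * .reg 0) + .reg 11)
      (.cell 1 (.reg 2 * (.reg 0 * .reg 0) + .reg 11)))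

/-- Process one edge set. -/
def stepProg : Prog :=
  .seq profileProg <| .seq vectorProg <| .seq reduceProg <| .seq copyProg
    (.assign 3 (.reg 3 + .reg 14))

/-- The whole algorithm. -/
def mainProg : Prog :=
  .seq powersProg <| .seq (.assign 3 (.const 0)) <| .seq (forLoop 2 (.reg 1) stepProg)
    (.assign 0 (.reg 3))

/-! ### What the parts of the program compute -/

/-- The degree of vertex `u` in the edge set number `i`. -/
def rowSum (F : ℕ → ℕ) (k i u : ℕ) : ℕ :=
  ∑ v ∈ Finset.range k, F ((i * k + u) * k + v)

/-- The code of the degrees of the first `n` vertices. -/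
def degreeCode (F : ℕ → ℕ) (k i : ℕ) : ℕ → ℕ
  | 0 => 0
  | n + 1 => 3 * degreeCode F k i n + rowSum F k i n % 3

/-- Whether the first `n` vertices have degree at most `2`. -/
def degreeTest (F : ℕ → ℕ) (k i n : ℕ) : ℕ :=
  ∏ u ∈ Finset.range n, (1 - rowSum F k i u / 3)

/-- The entry of the cut vector of the edge set number `i` at the cut `q`. -/
def cutValue (F : ℕ → ℕ) (k i q : ℕ) : ℕ :=
  degreeTest F k i k * (q % 2) * ∏ x ∈ Finset.range (k * k),
    (1 - F (i * (k * k) + x) * ((q / 2 ^ (x / k) + q / 2 ^ (x % k)) % 2))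

/-- Every digit is reduced modulo 3, so the bound also holds for edge sets with large degrees. -/
theorem degreeCode_lt (F : ℕ → ℕ) (k i n : ℕ) : degreeCode F k i n < 3 ^ n := by
  induction n with
  | zero => simp [degreeCode]
  | succ n ih => rw [degreeCode, pow_succ]; omega

theorem degreeTest_le_one (F : ℕ → ℕ) (k i n : ℕ) : degreeTest F k i n ≤ 1 :=
  Finset.prod_le_one' fun _ _ => Nat.sub_le _ _

/-! ### Results and running times of the subroutines. -/

theorem exec_powersProg {W k : ℕ} {σ : State} (h0 : σ.reg 0 = k) (hW : k < W) :
    Exec W ((k + 1) * 100) powersProg σ fun τ =>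
      τ.reg 5 = 2 ^ k ∧ ∀ u < k, τ.arr 5 u = 2 ^ u := by
  -- The last power computed, `2 ^ k`, has `k + 1` bits; this is where `k < W` enters.
  have hpow : ∀ u ≤ k, (2 ^ u).size ≤ W := fun u hu => by
    rw [Nat.size_pow]; omega
  refine Exec.seq 5 ((k + 1) * 60) (fun τ => τ.reg 5 = 1) (Exec.assign ?_ ?_) (fun τ hτ h5 =>
    Exec.forLoop 30 k (fun j ρ => ρ.reg 5 = 2 ^ j ∧ ∀ u < j, ρ.arr 5 u = 2 ^ u)
    (by decide) ?_ ?_ ?_ ?_ ?_) ?_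
  · exact fun _ => by simpa using hpow 0 (by omega)
  · simp
  · intro ρ hρ
    simp [hρ.reg 0 (by decide), hτ.reg 0 (by decide), h0]
  · exact (Nat.size_le.2 Nat.lt_two_pow_self).trans hW.le
  · simp [h5]
  · intro j hj ρ hρ h7 ⟨h5, h⟩
    refine Exec.seq 10 10 (fun ρ' => ∀ u < j + 1, ρ'.arr 5 u = 2 ^ u)
      (Exec.write ?_ ?_) (fun ρ' hρ' h' => Exec.assign ?_ ?_) (by decide)
    · intro; simpa [h5] using hpow j hj.le
    · intro u hu
      simp only [Expr.eval_reg, State.setCell_arr_self, h7, h5]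
      split_ifs with hu'
      · rw [hu']
      · exact h u (by omega)
    · intro
      simpa [hρ'.reg 5 (by decide), h5, ← pow_succ] using hpow (j + 1) hj
    · simpa [hρ'.reg 5 (by decide), h5, ← pow_succ] using h'
  · exact Nat.mul_le_mul_left _ (by decide)
  · omega

theorem exec_degreeProg {W k i u : ℕ} {σ : State} (h0 : σ.reg 0 = k) (h2 : σ.reg 2 = i)
    (h7 : σ.reg 7 = u) (hF : ∀ x, σ.arr 1 x ≤ 1) (hW : k < 2 ^ W) :
    Exec W ((k + 1) * 200) degreeProg σ fun τ => τ.reg 9 = rowSum (σ.arr 1) k i u := by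
  have hsize : ∀ x ≤ k, x.size ≤ W := fun x hx => Nat.size_le.2 (hx.trans_lt hW)
  refine Exec.seq 5 ((k + 1) * 130) (fun τ => τ.reg 9 = 0) (Exec.assign ?_ ?_) (fun τ hτ h9 =>
    Exec.forLoop 100 k
    (fun j ρ => ρ.reg 9 = ∑ v ∈ Finset.range j, σ.arr 1 ((i * k + u) * k + v))
    (by decide) ?_ ?_ ?_ ?_ ?_) ?_
  · simp
  · simp
  · intro ρ hρ
    simp [hρ.reg 0 (by decide), hτ.reg 0 (by decide), h0]
  · exact hsize k le_rfl
  · simp [h9]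
  · intro j hj ρ hρ h8 h
    have hev : (.reg 9 + .cell 1 ((.reg 2 * .reg 0 + .reg 7) * .reg 0 + .reg 8) : Expr).eval ρ =
        ∑ v ∈ Finset.range (j + 1), σ.arr 1 ((i * k + u) * k + v) := by
      simp [Finset.sum_range_succ, h, h8, hρ.reg 0 (by decide), hτ.reg 0 (by decide), h0,
        hρ.reg 2 (by decide), hτ.reg 2 (by decide), h2, hρ.reg 7 (by decide),
        hτ.reg 7 (by decide), h7, hρ.arr 1 (by decide), hτ.arr 1 (by decide)]
    refine (Exec.assign ?_ ?_)
    · intro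
      rw [hev]
      refine hsize _ ((Finset.sum_le_card_nsmul _ _ 1 fun _ _ => hF _).trans ?_)
      simpa using hj
    · simp [hev]
  · exact Nat.mul_le_mul_left _ (by decide)
  · omega

theorem exec_profileProg {W k i : ℕ} {σ : State} (h0 : σ.reg 0 = k) (h2 : σ.reg 2 = i)
    (hF : ∀ x, σ.arr 1 x ≤ 1) (hW : 3 ^ k < 2 ^ W) :
    Exec W ((k + 1) * ((k + 1) * 400)) profileProg σ fun τ =>
      τ.reg 4 = degreeCode (σ.arr 1) k i k ∧ τ.reg 6 = degreeTest (σ.arr 1) k i k := by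
  have hk : k < 2 ^ W := (Nat.lt_pow_self (by norm_num)).trans hW
  have hone : 1 < 2 ^ W := (Nat.one_le_pow _ _ (by norm_num)).trans_lt hW
  refine Exec.seq 5 ((k + 1) * ((k + 1) * 360)) (fun τ => τ.reg 4 = 0) (Exec.assign ?_ ?_)
    (fun τ hτ h4 => Exec.seq 5 ((k + 1) * ((k + 1) * 350)) (fun τ' => τ'.reg 6 = 1)
    (Exec.assign ?_ ?_) (fun τ' hτ' h6 => Exec.forLoop ((k + 1) * 300) k
    (fun j ρ => ρ.reg 4 = degreeCode (σ.arr 1) k i j ∧ ρ.reg 6 = degreeTest (σ.arr 1) k i j)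
    (by decide) ?_ ?_ ?_ ?_ ?_) ?_) ?_
  · simp
  · simp
  · intro; exact Nat.size_le.2 hone
  · simp
  · intro ρ hρ
    simp [hρ.reg 0 (by decide), hτ'.reg 0 (by decide), hτ.reg 0 (by decide), h0]
  · exact Nat.size_le.2 hk
  · simp [hτ'.reg 4 (by decide), h4, h6, degreeCode, degreeTest]
  · intro j hj ρ hρ h7 ⟨h4, h6⟩
    have hρ1 : ρ.arr 1 = σ.arr 1 := by
      rw [hρ.arr 1 (by decide), hτ'.arr 1 (by decide), hτ.arr 1 (by decide)]
    have hρ0 : ρ.reg 0 = k := by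
      rw [hρ.reg 0 (by decide), hτ'.reg 0 (by decide), hτ.reg 0 (by decide), h0]
    have hρ2 : ρ.reg 2 = i := by
      rw [hρ.reg 2 (by decide), hτ'.reg 2 (by decide), hτ.reg 2 (by decide), h2]
    refine Exec.seq ((k + 1) * 200) 80 _
      (exec_degreeProg hρ0 hρ2 h7 (by rwa [hρ1]) hk) (fun ρ' hρ' h9 => ?_) (by omega)
    rw [hρ1] at h9
    refine Exec.seq 40 40 (fun μ => μ.reg 4 = degreeCode (σ.arr 1) k i (j + 1))
      (Exec.assign ?_ ?_) (fun μ hμ h4' => Exec.assign ?_ ?_) (by decide)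
    · intro
      have := degreeCode_lt (σ.arr 1) k i (j + 1)
      have h3 : 3 ^ (j + 1) ≤ 3 ^ k := Nat.pow_le_pow_right (by norm_num) hj
      rw [degreeCode] at this
      simpa [hρ'.reg 4 (by decide), h4, h9] using Nat.size_le.2 (by omega)
    · simp [hρ'.reg 4 (by decide), h4, h9, degreeCode]
    · intro
      have := degreeTest_le_one (σ.arr 1) k i (j + 1)
      rw [degreeTest, Finset.prod_range_succ, ← degreeTest] at this
      simpa [hρ'.reg 6 (by decide), h6, hμ.reg 6 (by decide), hμ.reg 9 (by decide), h9]
        using Nat.size_le.2 (by omega)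
    · simp [h4', hρ'.reg 6 (by decide), h6, hμ.reg 6 (by decide), hμ.reg 9 (by decide), h9,
        degreeTest, Finset.prod_range_succ]
  · refine Nat.mul_le_mul_left _ ?_
    have : 2 * (Expr.reg 0).weight + (Expr.reg 0).bits + 20 = 23 := rfl
    omega
  · nlinarith
  · nlinarith

theorem exec_cutProg {W k i q : ℕ} {σ : State} (h0 : σ.reg 0 = k) (h2 : σ.reg 2 = i)
    (h6 : σ.reg 6 = degreeTest (σ.arr 1) k i k) (h10 : σ.reg 10 = q)
    (h5 : ∀ u < k, σ.arr 5 u = 2 ^ u) (hW : k * k < 2 ^ W) (hone : 1 < 2 ^ W) :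
    Exec W ((k * k + 1) * 500) cutProg σ fun τ => τ.reg 12 = cutValue (σ.arr 1) k i q := by
  set F := σ.arr 1 with hF
  have hle : ∀ n, degreeTest F k i k * (q % 2) * ∏ x ∈ Finset.range n,
      (1 - F (i * (k * k) + x) * ((q / 2 ^ (x / k) + q / 2 ^ (x % k)) % 2)) < 2 ^ W := by
    intro n
    refine (Nat.mul_le_mul (Nat.mul_le_mul (degreeTest_le_one F k i k)
      (Nat.le_of_lt_succ (Nat.mod_lt q two_pos)))
      (Finset.prod_le_one' fun _ _ => Nat.sub_le _ _)).trans_lt (by simpa using hone)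
  refine Exec.seq 30 ((k * k + 1) * 400)
    (fun τ => τ.reg 12 = degreeTest F k i k * (q % 2)) (Exec.assign ?_ ?_) (fun τ hτ h12 =>
    Exec.forLoop 300 (k * k)
    (fun j ρ => ρ.reg 12 = degreeTest F k i k * (q % 2) * ∏ x ∈ Finset.range j,
      (1 - F (i * (k * k) + x) * ((q / 2 ^ (x / k) + q / 2 ^ (x % k)) % 2)))
    (by decide) ?_ ?_ ?_ ?_ ?_) ?_
  · intro; simpa [h6, h10] using Nat.size_le.2 (hle 0)
  · simp [h6, h10]
  · intro ρ hρ
    simp [hρ.reg 0 (by decide), hτ.reg 0 (by decide), h0]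
  · exact Nat.size_le.2 hW
  · simp [h12]
  · intro j hj ρ hρ h11 h
    have hk : 0 < k := Nat.pos_of_ne_zero fun h => by simp [h] at hj
    have hev : (.reg 12 * (.const 1 - .cell 1 (.reg 2 * (.reg 0 * .reg 0) + .reg 11) *
        ((.reg 10 / .cell 5 (.reg 11 / .reg 0) + .reg 10 / .cell 5 (.reg 11 % .reg 0)) %
          .const 2)) : Expr).eval ρ = degreeTest F k i k * (q % 2) *
        ∏ x ∈ Finset.range (j + 1),
          (1 - F (i * (k * k) + x) * ((q / 2 ^ (x / k) + q / 2 ^ (x % k)) % 2)) := by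
      simp [Finset.prod_range_succ, h, h11, hρ.reg 0 (by decide), hτ.reg 0 (by decide), h0,
        hρ.reg 2 (by decide), hτ.reg 2 (by decide), h2, hρ.reg 10 (by decide),
        hτ.reg 10 (by decide), h10, hρ.arr 1 (by decide), hτ.arr 1 (by decide),
        hρ.arr 5 (by decide), hτ.arr 5 (by decide), ← hF, h5 _ (Nat.mod_lt j hk),
        h5 _ (Nat.div_lt_of_lt_mul hj), mul_assoc]
    refine Exec.assign ?_ ?_
    · intro
      rw [hev]
      exact Nat.size_le.2 (hle _)
    · simp only [State.setReg_reg, hev]; simp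
  · exact Nat.mul_le_mul_left _ (by decide)
  · omega

theorem exec_vectorProg {W k i : ℕ} {σ : State} (h0 : σ.reg 0 = k) (h2 : σ.reg 2 = i)
    (hK : σ.reg 5 = 2 ^ k) (h6 : σ.reg 6 = degreeTest (σ.arr 1) k i k)
    (h5 : ∀ u < k, σ.arr 5 u = 2 ^ u) (hW : k * k < 2 ^ W) (hkW : k < W) :
    Exec W ((2 ^ k + 1) * ((k * k + 1) * 600)) vectorProg σ fun τ =>
      ∀ q < 2 ^ k, τ.arr 3 q = cutValue (σ.arr 1) k i q := by
  have hone : 1 < 2 ^ W := Nat.one_lt_two_pow (by omega)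
  refine Exec.forLoop ((k * k + 1) * 550) (2 ^ k)
    (fun j ρ => ∀ q < j, ρ.arr 3 q = cutValue (σ.arr 1) k i q) (by decide) ?_ ?_ ?_ ?_ ?_
  · intro ρ hρ
    simp [hρ.reg 5 (by decide), hK]
  · rw [Nat.size_pow]; omega
  · simp
  · intro j hj ρ hρ h10 h
    have hρ1 : ρ.arr 1 = σ.arr 1 := hρ.arr 1 (by decide)
    refine Exec.seq ((k * k + 1) * 500) 10 _ (exec_cutProg (k := k) (i := i) (q := j) ?_ ?_ ?_
      h10 ?_ hW hone) (fun ρ' hρ' h12 => Exec.write ?_ ?_) (by omega)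
    · rw [hρ.reg 0 (by decide), h0]
    · rw [hρ.reg 2 (by decide), h2]
    · rw [hρ.reg 6 (by decide), h6, hρ1]
    · rwa [hρ.arr 5 (by decide)]
    · exact fun hb => hb.reg 12
    · intro q hq
      rw [hρ1] at h12
      simp only [State.setReg_arr, State.setCell_arr_self, Expr.eval_reg,
        hρ'.reg 10 (by decide), h10, h12, hρ'.arr 3 (by decide)]
      split_ifs with hq'
      · rw [hq']
      · exact h q (by omega)
  · refine Nat.mul_le_mul_left _ ?_
    have : 2 * (Expr.reg 5).weight + (Expr.reg 5).bits + 20 = 23 := rfl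
    omega

/-- Every edge set is copied, selected or not. Without selection the counter does not move, so the
copy stays outside the output. The second clause protects the earlier blocks. -/
theorem exec_copyProg {W k i c : ℕ} {σ : State} (h0 : σ.reg 0 = k) (h2 : σ.reg 2 = i)
    (h3 : σ.reg 3 = c) (hW : k * k < 2 ^ W) :
    Exec W ((k * k + 1) * 200) copyProg σ fun τ =>
      (∀ x < k * k, τ.arr 2 (c * (k * k) + x) = σ.arr 1 (i * (k * k) + x)) ∧
        ∀ y < c * (k * k), τ.arr 2 y = σ.arr 2 y := by
  refine Exec.forLoop 150 (k * k)
    (fun j ρ => (∀ x < j, ρ.arr 2 (c * (k * k) + x) = σ.arr 1 (i * (k * k) + x)) ∧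
        ∀ y < c * (k * k), ρ.arr 2 y = σ.arr 2 y) (by decide) ?_ ?_ ?_ ?_ ?_
  · intro ρ hρ
    simp [hρ.reg 0 (by decide), h0]
  · exact Nat.size_le.2 hW
  · simp
  · intro j hj ρ hρ h11 ⟨h, h'⟩
    refine Exec.write (fun hb => hb.arr _ _) ⟨fun x hx => ?_, fun y hy => ?_⟩
    · simp only [State.setReg_arr, State.setCell_arr_self, Expr.eval_reg, Expr.eval_add,
        Expr.eval_mul, Expr.eval_cell, hρ.reg 3 (by decide), h3, hρ.reg 0 (by decide), h0,
        hρ.reg 2 (by decide), h2, h11, hρ.arr 1 (by decide)]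
      split_ifs with hx'
      · rw [show x = j by omega]
      · exact h x (by omega)
    · simp only [State.setReg_arr, State.setCell_arr_self, Expr.eval_reg, Expr.eval_add,
        Expr.eval_mul, Expr.eval_cell, hρ.reg 3 (by decide), h3, hρ.reg 0 (by decide), h0,
        hρ.reg 2 (by decide), h2, h11, hρ.arr 1 (by decide)]
      rw [if_neg (by omega)]
      exact h' y hy
  · exact Nat.mul_le_mul_left _ (by decide)

/-- Uniqueness of digits in base `K`, the leading digit being unbounded. It serves both the layout
of the bases and that of the input family. -/
theorem address_injective {K d p q d' p' q' : ℕ} (hp : p < K) (hq : q < K) (hp' : p' < K)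
    (hq' : q' < K) :
    (d * K + p) * K + q = (d' * K + p') * K + q' ↔ d = d' ∧ p = p' ∧ q = q' := by
  have aux : ∀ {a b a' b' : ℕ}, b < K → b' < K → a * K + b = a' * K + b' → a = a' ∧ b = b' := by
    intro a b a' b' hb hb' h
    have h1 := congrArg (· / K) h
    have h2 := congrArg (· % K) h
    have hK : 0 < K := by omega
    simp only [Nat.mul_add_mod', Nat.mod_eq_of_lt hb, Nat.mod_eq_of_lt hb'] at h2
    simp only [add_comm (_ * K), Nat.add_mul_div_right _ _ hK, Nat.div_eq_of_lt hb,
      Nat.div_eq_of_lt hb', zero_add] at h1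
    exact ⟨h1, h2⟩
  constructor
  · intro h
    obtain ⟨h1, h2⟩ := aux hq hq' h
    obtain ⟨h3, h4⟩ := aux hp hp' h1
    exact ⟨h3, h4, h2⟩
  · rintro ⟨rfl, rfl, rfl⟩; rfl

theorem exec_storeProg {W K d p : ℕ} {σ : State} (h4 : σ.reg 4 = d) (h5 : σ.reg 5 = K)
    (h13 : σ.reg 13 = p) (hp : p < K) (hW : K < 2 ^ W) :
    Exec W ((K + 1) * 200) storeProg σ fun τ => τ.reg 14 = 1 ∧
      ∀ d' p' q', p' < K → q' < K → τ.arr 4 ((d' * K + p') * K + q') =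
        if d' = d ∧ p' = p then σ.arr 3 q' else σ.arr 4 ((d' * K + p') * K + q') := by
  refine Exec.seq ((K + 1) * 150) 10 (fun τ => ∀ d' p' q', p' < K → q' < K →
      τ.arr 4 ((d' * K + p') * K + q') = if d' = d ∧ p' = p then σ.arr 3 q'
      else σ.arr 4 ((d' * K + p') * K + q'))
    (Exec.mono (Exec.forLoop 100 K (fun j τ => ∀ d' p' q', p' < K → q' < K →
      τ.arr 4 ((d' * K + p') * K + q') = if d' = d ∧ p' = p ∧ q' < j then σ.arr 3 q'
      else σ.arr 4 ((d' * K + p') * K + q')) (by decide) ?_ ?_ ?_ ?_ le_rfl) ?_ ?_)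
    (fun τ hτ h => Exec.assign ?_ ?_) (by omega)
  · intro ρ hρ
    simp [hρ.reg 5 (by decide), h5]
  · exact Nat.size_le.2 hW
  · simp
  · intro j hj ρ hρ h10 h
    refine Exec.write (fun hb => hb.arr _ _) fun d' p' q' hp' hq' => ?_
    simp only [State.setReg_arr, State.setCell_arr_self, Expr.eval_reg, Expr.eval_add,
      Expr.eval_mul, Expr.eval_cell, hρ.reg 4 (by decide), h4, hρ.reg 5 (by decide), h5,
      hρ.reg 13 (by decide), h13, h10, hρ.arr 3 (by decide), address_injective hp' hq' hp hj,
      h d' p' q' hp' hq']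
    have : q' < j + 1 ↔ q' < j ∨ q' = j := by omega
    split_ifs <;> grind
  · exact Nat.mul_le_mul_left _ (by decide)
  · intro τ _ h d' p' q' hp' hq'
    simpa [hq'] using h d' p' q' hp' hq'
  · intro; exact Nat.size_le.2 ((by omega : 1 ≤ K).trans_lt hW)
  · simpa using h

theorem exec_addProg {W K d p : ℕ} {σ : State} (h4 : σ.reg 4 = d) (h5 : σ.reg 5 = K)
    (h13 : σ.reg 13 = p) (hp : p < K) (hW : K < 2 ^ W) :
    Exec W ((K + 1) * 200) addProg σ fun τ =>
      ∀ q < K, τ.arr 3 q = (σ.arr 3 q + σ.arr 4 ((d * K + p) * K + q)) % 2 := by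
  -- The update is in place, so the invariant must also record that the entries from `j` on still
  -- have their old values.
  refine Exec.mono (Exec.forLoop 100 K (fun j τ => ∀ q, τ.arr 3 q = if q < j then
      (σ.arr 3 q + σ.arr 4 ((d * K + p) * K + q)) % 2 else σ.arr 3 q)
      (by decide) ?_ ?_ ?_ ?_ le_rfl) ?_ ?_
  · intro ρ hρ
    simp [hρ.reg 5 (by decide), h5]
  · exact Nat.size_le.2 hW
  · simp
  · intro j hj ρ hρ h10 h
    have hρj : ρ.arr 3 j = σ.arr 3 j := by simp [h j]
    refine Exec.write (fun _ => ?_) fun q => ?_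
    · refine Nat.size_le.2 (lt_of_lt_of_le (Nat.mod_lt _ two_pos) ?_)
      have : 1 < 2 ^ W := (by omega : 1 ≤ K).trans_lt hW
      exact this
    · simp only [State.setReg_arr, State.setCell_arr_self, Expr.eval_reg, Expr.eval_add,
        Expr.eval_mul, Expr.eval_cell, Expr.eval_mod, Expr.eval_const, hρ.reg 4 (by decide), h4,
        hρ.reg 5 (by decide), h5, hρ.reg 13 (by decide), h13, h10, hρ.arr 4 (by decide), hρj]
      split_ifs with hq hq' hq'
      · rw [hq]
      · omega
      · rw [h q, if_pos (by omega)]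
      · rw [h q, if_neg (by omega)]
  · exact Nat.mul_le_mul_left _ (by decide)
  · intro τ _ h q hq
    simpa [hq] using h q

/-! ### Gaussian elimination over the field with two elements -/

/-- The inner product of two vectors of length `K`. -/
def pairing (K : ℕ) (x w : ℕ → ℕ) : ℕ := ∑ q ∈ Finset.range K, x q * w q

theorem pairing_congr {K : ℕ} {x y : ℕ → ℕ} (h : ∀ q < K, x q = y q) (w : ℕ → ℕ) :
    pairing K x w = pairing K y w :=
  Finset.sum_congr rfl fun q hq => by rw [h q (Finset.mem_range.1 hq)]

theorem pairing_eq_zero {K : ℕ} {x : ℕ → ℕ} (h : ∀ q < K, x q = 0) (w : ℕ → ℕ) :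
    pairing K x w = 0 :=
  Finset.sum_eq_zero fun q hq => by rw [h q (Finset.mem_range.1 hq), zero_mul]

theorem pairing_add_mod {K : ℕ} {x y z : ℕ → ℕ} (h : ∀ q < K, z q = (x q + y q) % 2)
    (w : ℕ → ℕ) : pairing K z w ≡ pairing K x w + pairing K y w [MOD 2] := by
  rw [pairing, pairing, pairing, ← Finset.sum_add_distrib]
  refine Nat.ModEq.sum fun q hq => ?_
  rw [h q (Finset.mem_range.1 hq), ← add_mul]
  exact (Nat.mod_modEq _ 2).mul_right _

/-- `w` is orthogonal modulo two to the vectors with index in `l` and code `d`. -/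
def Annihilates (K : ℕ) (v : ℕ → ℕ → ℕ) (c : ℕ → ℕ) (l : List ℕ) (d : ℕ) (w : ℕ → ℕ) : Prop :=
  ∀ t ∈ l, c t = d → 2 ∣ pairing K (v t) w

theorem Annihilates.mono {K : ℕ} {v : ℕ → ℕ → ℕ} {c : ℕ → ℕ} {l l' : List ℕ} {d : ℕ}
    {w : ℕ → ℕ} (h : Annihilates K v c l' d w) (hl : l ⊆ l') : Annihilates K v c l d w :=
  fun t ht => h t (hl ht)

/-- For each code `d`, the rows `B d p` with nonzero pivot are in echelon form and are spanned by
the vectors with index in `l` and code `d`; there are at least as many rows as members of `l`. -/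
structure Echelon (D K : ℕ) (v : ℕ → ℕ → ℕ) (c : ℕ → ℕ) (l : List ℕ) (B : ℕ → ℕ → ℕ → ℕ) :
    Prop where
  pivot : ∀ d, ∀ p < K, B d p p ≠ 0 → B d p p = 1 ∧ ∀ q < p, B d p q = 0
  span : ∀ d, ∀ p < K, B d p p ≠ 0 → ∀ w, Annihilates K v c l d w → 2 ∣ pairing K (B d p) w
  card : ∃ P : Finset (ℕ × ℕ), l.length = P.card ∧
    ∀ x ∈ P, x.1 < D ∧ x.2 < K ∧ B x.1 x.2 x.2 ≠ 0

theorem Echelon.length_le {D K : ℕ} {v : ℕ → ℕ → ℕ} {c : ℕ → ℕ} {l : List ℕ}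
    {B : ℕ → ℕ → ℕ → ℕ} (h : Echelon D K v c l B) : l.length ≤ D * K := by
  obtain ⟨P, hP, h⟩ := h.card
  rw [hP]
  have : P ⊆ Finset.range D ×ˢ Finset.range K := fun x hx => by
    have := h x hx
    simp only [Finset.mem_product, Finset.mem_range]
    exact ⟨this.1, this.2.1⟩
  simpa using Finset.card_le_card this

theorem Echelon.nil (D K : ℕ) (v : ℕ → ℕ → ℕ) (c : ℕ → ℕ) {B : ℕ → ℕ → ℕ → ℕ}
    (hB : ∀ d p q, B d p q = 0) : Echelon D K v c [] B where
  pivot d p _ h := absurd (hB d p p) h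
  span d p _ h := absurd (hB d p p) h
  card := ⟨∅, by simp⟩

theorem Echelon.congr {D K : ℕ} {v : ℕ → ℕ → ℕ} {c : ℕ → ℕ} {l : List ℕ}
    {B B' : ℕ → ℕ → ℕ → ℕ} (h : Echelon D K v c l B) (hB : B' = B) : Echelon D K v c l B' :=
  hB ▸ h

/-- The slot `(c i, p)` was empty, so storing adds a new pivot position and the count keeps up with
the list. Spans are expressed through annihilators: modulo vectors already spanned, `V` pairs like
`v i`, which now belongs to the list. -/
theorem Echelon.store {D K : ℕ} {v : ℕ → ℕ → ℕ} {c : ℕ → ℕ} {l : List ℕ}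
    {B B' : ℕ → ℕ → ℕ → ℕ} (h : Echelon D K v c l B) {i p : ℕ} {V : ℕ → ℕ} (hp : p < K)
    (hc : c i < D) (hB : B (c i) p p = 0) (hVp : V p = 1) (hV : ∀ q < p, V q = 0)
    (hspan : ∀ w, Annihilates K v c l (c i) w → pairing K V w ≡ pairing K (v i) w [MOD 2])
    (hB' : ∀ d' p' q', p' < K → q' < K →
      B' d' p' q' = if d' = c i ∧ p' = p then V q' else B d' p' q') :
    Echelon D K v c (l ++ [i]) B' where
  pivot d p' hp' hne := by
    rw [hB' d p' p' hp' hp'] at hne ⊢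
    by_cases hd : d = c i ∧ p' = p
    · obtain ⟨rfl, rfl⟩ := hd
      refine ⟨by simpa using hVp, fun q hq => ?_⟩
      rw [hB' _ _ _ hp' (hq.trans hp')]
      simpa using hV q hq
    · rw [if_neg hd] at hne ⊢
      refine ⟨(h.pivot d p' hp' hne).1, fun q hq => ?_⟩
      rw [hB' _ _ _ hp' (hq.trans hp'), if_neg hd]
      exact (h.pivot d p' hp' hne).2 q hq
  span d p' hp' hne w hw := by
    have hw' : Annihilates K v c l d w := hw.mono (List.subset_append_left _ _)
    rw [hB' d p' p' hp' hp'] at hne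
    by_cases hd : d = c i ∧ p' = p
    · obtain ⟨rfl, rfl⟩ := hd
      rw [pairing_congr (y := V) fun q hq => by rw [hB' _ _ _ hp' hq]; simp]
      exact ((hspan w hw').dvd_iff dvd_rfl).2 (hw i (by simp) rfl)
    · rw [if_neg hd] at hne
      rw [pairing_congr (y := B d p') fun q hq => by rw [hB' _ _ _ hp' hq, if_neg hd]]
      exact h.span d p' hp' hne w hw'
  card := by
    obtain ⟨P, hP, hmem⟩ := h.card
    have hnot : (c i, p) ∉ P := fun hx => (hmem _ hx).2.2 hB
    refine ⟨insert (c i, p) P, ?_, fun x hx => ?_⟩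
    · rw [Finset.card_insert_of_notMem hnot, List.length_append, hP, List.length_singleton]
    · rcases Finset.mem_insert.1 hx with rfl | hx
      · exact ⟨hc, hp, by simp [hB' _ _ _ hp hp, hVp]⟩
      · obtain ⟨h1, h2, h3⟩ := hmem x hx
        refine ⟨h1, h2, ?_⟩
        rw [hB' _ _ _ h2 h2]
        split_ifs with hd
        · exact absurd (hd.1 ▸ hd.2 ▸ h3 : B (c i) p p ≠ 0) (not_not.2 hB)
        · exact h3

/-- The list `l`, followed by `i` if `f ≠ 0`. -/
def extend (l : List ℕ) (i f : ℕ) : List ℕ := if f = 0 then l else l ++ [i]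

/-- The state of the elimination of the vector number `i` before the pivot `p`: the current vector
is `V`, and `f` tells whether `V` has been stored. -/
structure Reducing (D K : ℕ) (v : ℕ → ℕ → ℕ) (c : ℕ → ℕ) (l : List ℕ) (i p : ℕ)
    (B : ℕ → ℕ → ℕ → ℕ) (V : ℕ → ℕ) (f : ℕ) : Prop where
  flag : f ≤ 1
  le_one : ∀ q < K, V q ≤ 1
  zero : ∀ q < p, q < K → V q = 0
  done : f ≠ 0 → ∀ q < K, V q = 0
  echelon : Echelon D K v c (extend l i f) B
  modEq : ∀ w, Annihilates K v c (extend l i f) (c i) w →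
    pairing K V w ≡ pairing K (v i) w [MOD 2]

section step

variable {D K : ℕ} {v : ℕ → ℕ → ℕ} {c : ℕ → ℕ} {l : List ℕ} {i p : ℕ} {B B' : ℕ → ℕ → ℕ → ℕ}
  {V V' : ℕ → ℕ} {f : ℕ}

theorem Reducing.start (h : Echelon D K v c l B) (hV : ∀ q < K, V q = v i q)
    (hv : ∀ q < K, v i q ≤ 1) : Reducing D K v c l i 0 B V 0 where
  flag := zero_le_one
  le_one q hq := by rw [hV q hq]; exact hv q hq
  zero q hq := absurd hq (Nat.not_lt_zero q)
  done h := absurd rfl h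
  echelon := by simpa [extend] using h
  modEq w _ := by rw [pairing_congr hV]

theorem Reducing.skip (h : Reducing D K v c l i p B V f) (hV : V p = 0) :
    Reducing D K v c l i (p + 1) B V f where
  flag := h.flag
  le_one := h.le_one
  zero q hq hqK := by
    rcases Nat.lt_succ_iff_lt_or_eq.1 hq with hq | rfl
    exacts [h.zero q hq hqK, hV]
  done := h.done
  echelon := h.echelon
  modEq := h.modEq

/-- The row is zero before its pivot, so cleared entries stay cleared, and at the pivot `1 + 1`
vanishes modulo 2. Pairings with annihilators do not change because the row itself is spanned. -/
theorem Reducing.reduce (h : Reducing D K v c l i p B V f) (hp : p < K) (hV : V p ≠ 0)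
    (hB : B (c i) p p ≠ 0) (hV' : ∀ q < K, V' q = (V q + B (c i) p q) % 2) :
    Reducing D K v c l i (p + 1) B V' f where
  flag := h.flag
  le_one q hq := by rw [hV' q hq]; omega
  zero q hq hqK := by
    rw [hV' q hqK]
    have hpiv := h.echelon.pivot (c i) p hp hB
    rcases Nat.lt_succ_iff_lt_or_eq.1 hq with hq | rfl
    · rw [h.zero q hq hqK, hpiv.2 q hq]
    · have := h.le_one q hqK
      rw [hpiv.1, show V q = 1 by omega]
  done hf := absurd (h.done hf p hp) hV
  echelon := h.echelon
  modEq w hw := by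
    refine (pairing_add_mod hV' w).trans (Nat.ModEq.trans ?_ (h.modEq w hw))
    exact (Nat.modEq_zero_iff_dvd.2 (h.echelon.span (c i) p hp hB w hw)).add_left _

/-- After being stored, the vector is added to itself and becomes zero, so all later pivots skip it
and it is stored only once. -/
theorem Reducing.store (h : Reducing D K v c l i p B V f) (hp : p < K) (hc : c i < D)
    (hV : V p ≠ 0) (hB : B (c i) p p = 0)
    (hB' : ∀ d' p' q', p' < K → q' < K →
      B' d' p' q' = if d' = c i ∧ p' = p then V q' else B d' p' q')
    (hV' : ∀ q < K, V' q = (V q + B' (c i) p q) % 2) :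
    Reducing D K v c l i (p + 1) B' V' 1 := by
  -- A vector stored earlier would be zero by now, against `V p ≠ 0`.
  have hf : f = 0 := by
    by_contra hf
    exact hV (h.done hf p hp)
  subst hf
  have hzero : ∀ q < K, V' q = 0 := fun q hq => by
    rw [hV' q hq, hB' _ _ _ hp hq]
    simp only [and_self, if_true]; omega
  have hech : Echelon D K v c (l ++ [i]) B' := by
    refine Echelon.store (by simpa [extend] using h.echelon) hp hc hB ?_
      (fun q hq => h.zero q hq (hq.trans hp)) (by simpa [extend] using h.modEq) hB'
    have := h.le_one p hp
    omega
  refine ⟨le_rfl, fun q hq => by simp [hzero q hq], fun q _ hq => hzero q hq,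
    fun _ => hzero, by simpa [extend] using hech, fun w hw => ?_⟩
  rw [pairing_eq_zero hzero]
  exact (Nat.modEq_zero_iff_dvd.2 (hw i (by simp [extend]) rfl)).symm

/-- After all pivots the remainder is zero, so `v i` pairs evenly with every annihilator of the
selected vectors of its code. -/
theorem Reducing.dvd (h : Reducing D K v c l i K B V f) (w : ℕ → ℕ)
    (hw : Annihilates K v c (extend l i f) (c i) w) : 2 ∣ pairing K (v i) w := by
  have := h.modEq w hw
  rw [pairing_eq_zero fun q hq => h.zero q hq hq] at this
  exact Nat.modEq_zero_iff_dvd.1 this.symm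

end step

/-! ### Elimination as executed by the program. -/

/-- The basis vectors stored in array `4`. -/
def rows (K : ℕ) (σ : State) (d p q : ℕ) : ℕ := σ.arr 4 ((d * K + p) * K + q)

theorem rows_congr {K : ℕ} {σ τ : State} (h : τ.arr 4 = σ.arr 4) : rows K τ = rows K σ := by
  funext d p q; rw [rows, h, rows]

@[simp] theorem rows_setReg (K : ℕ) (σ : State) (r x : ℕ) :
    rows K (σ.setReg r x) = rows K σ := rfl

theorem exec_pivotProg {W D K : ℕ} {v : ℕ → ℕ → ℕ} {c : ℕ → ℕ} {l : List ℕ} {i p : ℕ}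
    {σ : State} (h4 : σ.reg 4 = c i) (h5 : σ.reg 5 = K) (h13 : σ.reg 13 = p) (hp : p < K)
    (hc : c i < D) (hW : K < 2 ^ W)
    (h : Reducing D K v c l i p (rows K σ) (σ.arr 3) (σ.reg 14)) :
    Exec W ((K + 1) * 500) pivotProg σ fun τ =>
      Reducing D K v c l i (p + 1) (rows K τ) (τ.arr 3) (τ.reg 14) := by
  have hw1 : (Expr.cell 3 (.reg 13)).weight = 2 := rfl
  have hw2 : (Expr.cell 4 ((.reg 4 * .reg 5 + .reg 13) * .reg 5 + .reg 13)).weight ≤ 40 := by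
    decide
  refine Exec.ite ((K + 1) * 490) (fun hV => ?_) (fun hV => Exec.skip ?_ ?_) (by omega)
  · replace hV : σ.arr 3 p ≠ 0 := by simpa [h13] using hV
    refine Exec.seq ((K + 1) * 250) ((K + 1) * 200)
      -- In both cases row `p` is now occupied, either from before or by the current vector, and the
      -- same addition clears the pivot entry.
      (fun ρ => (rows K σ (c i) p p ≠ 0 ∧ ρ = σ) ∨ (rows K σ (c i) p p = 0 ∧ ρ.reg 14 = 1 ∧
        ∀ d' p' q', p' < K → q' < K →
          rows K ρ d' p' q' = if d' = c i ∧ p' = p then σ.arr 3 q' else rows K σ d' p' q'))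
      (Exec.ite ((K + 1) * 200) (fun hB => Exec.skip ?_ ?_) (fun hB => ?_) ?_) ?_ ?_
    · exact Or.inl ⟨by simpa [rows, h4, h5, h13] using hB, rfl⟩
    · omega
    · refine (exec_storeProg h4 h5 h13 hp hW).mono le_rfl fun τ _ hτ => Or.inr ⟨?_, hτ⟩
      simpa [rows, h4, h5, h13] using hB
    · omega
    · intro ρ hρ hR
      have h3 : ρ.arr 3 = σ.arr 3 := hρ.arr 3 (by decide)
      have h4' : ρ.reg 4 = c i := by rw [hρ.reg 4 (by decide), h4]
      have h5' : ρ.reg 5 = K := by rw [hρ.reg 5 (by decide), h5]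
      have h13' : ρ.reg 13 = p := by rw [hρ.reg 13 (by decide), h13]
      refine (exec_addProg h4' h5' h13' hp hW).mono le_rfl fun τ hτ hadd => ?_
      rw [rows_congr (hτ.arr 4 (by decide)), hτ.reg 14 (by decide)]
      rcases hR with ⟨hB, rfl⟩ | ⟨hB, h14, hst⟩
      · exact h.reduce hp hV hB hadd
      · rw [h14]
        rw [h3] at hadd
        exact h.store hp hc hV hB hst hadd
    · omega
  · exact h.skip (by simpa [h13] using hV)
  · omega

theorem exec_reduceProg {W D K : ℕ} {v : ℕ → ℕ → ℕ} {c : ℕ → ℕ} {l : List ℕ} {i : ℕ}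
    {σ : State} (h4 : σ.reg 4 = c i) (h5 : σ.reg 5 = K) (hc : c i < D) (hW : K < 2 ^ W)
    (h : Echelon D K v c l (rows K σ)) (hV : ∀ q < K, σ.arr 3 q = v i q)
    (hv : ∀ q < K, v i q ≤ 1) :
    Exec W ((K + 1) * ((K + 1) * 600)) reduceProg σ fun τ => τ.reg 14 ≤ 1 ∧
      Echelon D K v c (extend l i (τ.reg 14)) (rows K τ) ∧
      ∀ w, Annihilates K v c (extend l i (τ.reg 14)) (c i) w → 2 ∣ pairing K (v i) w := by
  refine Exec.seq 10 ((K + 1) * ((K + 1) * 550)) (fun τ => τ.reg 14 = 0) (Exec.assign ?_ ?_)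
    (fun τ hτ h14 => Exec.mono (Exec.forLoop ((K + 1) * 500) K
      (fun j τ => Reducing D K v c l i j (rows K τ) (τ.arr 3) (τ.reg 14))
      (by decide) ?_ ?_ ?_ ?_ ?_) le_rfl ?_) ?_
  · simp
  · simp
  · intro ρ hρ
    simp [hρ.reg 5 (by decide), hτ.reg 5 (by decide), h5]
  · exact Nat.size_le.2 hW
  · have h3 : τ.arr 3 = σ.arr 3 := hτ.arr 3 (by decide)
    have hrows : rows K (τ.setReg 13 0) = rows K σ := rows_congr (hτ.arr 4 (by decide))
    rw [hrows]
    simpa [h14, h3] using Reducing.start h hV hv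
  · intro j hj ρ hρ h13 hI
    refine (exec_pivotProg ?_ ?_ h13 hj hc hW hI).mono le_rfl fun μ _ hμ => ?_
    · rw [hρ.reg 4 (by decide), hτ.reg 4 (by decide), h4]
    · rw [hρ.reg 5 (by decide), hτ.reg 5 (by decide), h5]
    · simpa using hμ
  · refine Nat.mul_le_mul_left _ ?_
    have : 2 * (Expr.reg 5).weight + (Expr.reg 5).bits + 20 = 23 := rfl
    omega
  · exact fun μ _ hμ => ⟨hμ.flag, hμ.echelon, fun w hw => hμ.dvd w hw⟩
  · nlinarith

/-! ### The main loop -/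

theorem cutValue_le_one (F : ℕ → ℕ) (k i q : ℕ) : cutValue F k i q ≤ 1 := by
  refine (Nat.mul_le_mul (Nat.mul_le_mul (degreeTest_le_one F k i k)
    (Nat.le_of_lt_succ (Nat.mod_lt q two_pos)))
    (Finset.prod_le_one' fun _ _ => Nat.sub_le _ _)).trans (by simp)

/-- The indices of the selected edge sets after the first `n` edge sets are `l`. -/
structure Selected (F : ℕ → ℕ) (k n : ℕ) (l : List ℕ) (σ : State) : Prop where
  nodup : l.Nodup
  lt : ∀ t ∈ l, t < n
  length : σ.reg 3 = l.length
  output : ∀ (j : ℕ) (hj : j < l.length), ∀ x < k * k,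
    σ.arr 2 (j * (k * k) + x) = F (l[j] * (k * k) + x)
  echelon : Echelon (3 ^ k) (2 ^ k) (cutValue F k) (fun i => degreeCode F k i k) l
    (rows (2 ^ k) σ)
  dvd : ∀ t < n, ∀ w, Annihilates (2 ^ k) (cutValue F k) (fun i => degreeCode F k i k) l
    (degreeCode F k t k) w → 2 ∣ pairing (2 ^ k) (cutValue F k t) w

/-- The time for one edge set. -/
def stepTime (k : ℕ) : ℕ := 2 ^ k * 2 ^ k * ((k + 1) * (k + 1) * 10000)

theorem exec_stepProg {W k i : ℕ} {F : ℕ → ℕ} {l : List ℕ} {σ : State} (h0 : σ.reg 0 = k)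
    (h2 : σ.reg 2 = i) (h5 : σ.reg 5 = 2 ^ k) (hF : σ.arr 1 = F) (hF1 : ∀ x, F x ≤ 1)
    (hpow : ∀ u < k, σ.arr 5 u = 2 ^ u) (hW : k * k < 2 ^ W) (hW3 : 3 ^ k < 2 ^ W)
    (hkW : k < W) (hiW : i + 1 < 2 ^ W) (h : Selected F k i l σ) :
    Exec W (stepTime k) stepProg σ fun τ => ∃ l', Selected F k (i + 1) l' τ := by
  have hK : 2 ^ k < 2 ^ W := Nat.pow_lt_pow_right (by norm_num) hkW
  subst hF
  refine Exec.seq _ _ _ (exec_profileProg h0 h2 hF1 hW3) (fun τ₁ a₁ h₁ =>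
    Exec.seq ((2 ^ k + 1) * ((k * k + 1) * 600)) _
      (fun τ => ∀ q < 2 ^ k, τ.arr 3 q = cutValue (σ.arr 1) k i q) ?_ (fun τ₂ a₂ h₂ =>
    Exec.seq ((2 ^ k + 1) * ((2 ^ k + 1) * 600)) _ _
      (exec_reduceProg (D := 3 ^ k) (v := cutValue (σ.arr 1) k)
      (c := fun i => degreeCode (σ.arr 1) k i k) (l := l) (i := i) ?_ ?_ ?_ hK ?_ h₂ ?_)
      (fun τ₃ a₃ h₃ => Exec.seq ((k * k + 1) * 200) 10 _
        (exec_copyProg (k := k) (i := i) (c := l.length) ?_ ?_ ?_ hW)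
      (fun τ₄ a₄ h₄ => Exec.assign ?_ ?_) le_rfl) le_rfl) le_rfl) ?_
  · have := exec_vectorProg (W := W) (k := k) (i := i) (σ := τ₁) (by rw [a₁.reg 0 (by decide), h0])
      (by rw [a₁.reg 2 (by decide), h2]) (by rw [a₁.reg 5 (by decide), h5])
      (by rw [a₁.arr 1 (by decide), h₁.2]) (by rwa [a₁.arr 5 (by decide)]) hW hkW
    rwa [a₁.arr 1 (by decide)] at this
  · rw [a₂.reg 4 (by decide), h₁.1]
  · rw [a₂.reg 5 (by decide), a₁.reg 5 (by decide), h5]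
  · exact degreeCode_lt _ _ _ _
  · refine h.echelon.congr (rows_congr ?_)
    rw [a₂.arr 4 (by decide), a₁.arr 4 (by decide)]
  · exact fun q _ => cutValue_le_one _ _ _ _
  · rw [a₃.reg 0 (by decide), a₂.reg 0 (by decide), a₁.reg 0 (by decide), h0]
  · rw [a₃.reg 2 (by decide), a₂.reg 2 (by decide), a₁.reg 2 (by decide), h2]
  · rw [a₃.reg 3 (by decide), a₂.reg 3 (by decide), a₁.reg 3 (by decide), h.length]
  -- The selected indices are distinct and below `i`, so the counter fits into a word even after an
  -- increment.
  all_goals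
    have hlen : l.length ≤ i := by
      have hsub : l.toFinset ⊆ Finset.range i := fun t ht =>
        Finset.mem_range.2 (h.lt t (List.mem_toFinset.1 ht))
      simpa [List.toFinset_card_of_nodup h.nodup] using Finset.card_le_card hsub
  · intro
    have h14 := h₃.1
    simp only [Expr.eval_add, Expr.eval_reg, a₄.reg 3 (by decide), a₃.reg 3 (by decide),
      a₂.reg 3 (by decide), a₁.reg 3 (by decide), h.length, a₄.reg 14 (by decide)]
    exact Nat.size_le.2 (by omega)
  · have h2arr : τ₃.arr 2 = σ.arr 2 := by
      rw [a₃.arr 2 (by decide), a₂.arr 2 (by decide), a₁.arr 2 (by decide)]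
    have h1arr : τ₃.arr 1 = σ.arr 1 := by
      rw [a₃.arr 1 (by decide), a₂.arr 1 (by decide), a₁.arr 1 (by decide)]
    rw [h1arr, h2arr] at h₄
    have h3reg : (Expr.reg 3 + Expr.reg 14).eval τ₄ = l.length + τ₃.reg 14 := by
      simp only [Expr.eval_add, Expr.eval_reg, a₄.reg 3 (by decide), a₃.reg 3 (by decide),
        a₂.reg 3 (by decide), a₁.reg 3 (by decide), h.length, a₄.reg 14 (by decide)]
    have hold : ∀ (j : ℕ) (hj : j < l.length), ∀ x < k * k,
        τ₄.arr 2 (j * (k * k) + x) = σ.arr 1 (l[j] * (k * k) + x) := by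
      intro j hj x hx
      rw [h₄.2 _ (by nlinarith), h.output j hj x hx]
    have hrows : rows (2 ^ k) (τ₄.setReg 3 (l.length + τ₃.reg 14)) = rows (2 ^ k) τ₃ :=
      rows_congr (a₄.arr 4 (by decide))
    have hext : l ⊆ extend l i (τ₃.reg 14) := by
      unfold extend; split_ifs <;> simp
    have hdvd : ∀ t < i + 1, ∀ w, Annihilates (2 ^ k) (cutValue (σ.arr 1) k)
        (fun i => degreeCode (σ.arr 1) k i k) (extend l i (τ₃.reg 14))
        (degreeCode (σ.arr 1) k t k) w → 2 ∣ pairing (2 ^ k) (cutValue (σ.arr 1) k t) w := by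
      intro t ht w hw
      rcases Nat.lt_succ_iff_lt_or_eq.1 ht with ht | rfl
      · exact h.dvd t ht w (hw.mono hext)
      · exact h₃.2.2 w hw
    refine ⟨extend l i (τ₃.reg 14), ?_, ?_, ?_, ?_, ?_, hdvd⟩
    · unfold extend
      split_ifs
      · exact h.nodup
      · refine List.Nodup.append h.nodup (List.nodup_singleton i) ?_
        simpa using fun hi => (h.lt i hi).false
    · intro t ht
      unfold extend at ht
      split_ifs at ht
      · exact (h.lt t ht).trans i.lt_succ_self
      · rcases List.mem_append.1 ht with ht | ht
        · exact (h.lt t ht).trans i.lt_succ_self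
        · rw [List.mem_singleton.1 ht]; exact i.lt_succ_self
    · have h14 := h₃.1
      simp only [h3reg, State.setReg_reg, if_true, extend]
      split_ifs with hf
      · simp [hf]
      · simp only [List.length_append, List.length_singleton]; omega
    · intro j hj x hx
      simp only [State.setReg_arr]
      by_cases hf : τ₃.reg 14 = 0
      · simp only [extend, hf, if_true] at hj ⊢
        exact hold j hj x hx
      · simp only [extend, hf, if_false, List.length_append, List.length_singleton] at hj ⊢
        rcases Nat.lt_succ_iff_lt_or_eq.1 hj with hj | rfl
        · rw [List.getElem_append_left hj]
          exact hold j hj x hx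
        · rw [List.getElem_append_right le_rfl]
          simpa using h₄.1 x hx
    · rw [h3reg, hrows]
      exact h₃.2.1
  -- In units of `K * K * (k + 1) ^ 2` with `K = 2 ^ k`, the parts cost at most 400, 1200, 2400 and
  -- 210, well below 10000.
  · have hK1 : 1 ≤ 2 ^ k := Nat.one_le_two_pow
    rw [stepTime]
    generalize 2 ^ k = K at hK1 ⊢
    have e1 : (k + 1) * ((k + 1) * 400) ≤ K * K * ((k + 1) * (k + 1) * 400) := by
      nlinarith [Nat.mul_le_mul hK1 hK1, Nat.zero_le ((k + 1) * (k + 1) * 400)]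
    have e2 : (K + 1) * ((k * k + 1) * 600) ≤ K * K * ((k + 1) * (k + 1) * 1200) := by
      calc (K + 1) * ((k * k + 1) * 600) ≤ (K * K * 2) * ((k + 1) * (k + 1) * 600) :=
            Nat.mul_le_mul (by nlinarith) (by nlinarith)
        _ = _ := by ring
    have e3 : (K + 1) * ((K + 1) * 600) ≤ K * K * ((k + 1) * (k + 1) * 2400) := by
      calc (K + 1) * ((K + 1) * 600) ≤ (2 * K) * ((2 * K) * 600) := by gcongr <;> omega
        _ = K * K * (1 * 2400) := by ring
        _ ≤ _ := by gcongr; nlinarith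
    have e4 : (k * k + 1) * 200 + 10 ≤ K * K * ((k + 1) * (k + 1) * 210) := by
      calc (k * k + 1) * 200 + 10 ≤ 1 * ((k + 1) * (k + 1) * 210) := by nlinarith
        _ ≤ _ := by gcongr; nlinarith
    have e5 := Nat.zero_le (K * K * ((k + 1) * (k + 1)))
    linarith

/-- The time for the whole algorithm on `m` edge sets. -/
def totalTime (k m : ℕ) : ℕ := (m + 1) * (stepTime k * 2)

theorem exec_mainProg {W k m : ℕ} {F : ℕ → ℕ} {σ : State} (h0 : σ.reg 0 = k) (h1 : σ.reg 1 = m)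
    (hF : σ.arr 1 = F) (hF1 : ∀ x, F x ≤ 1) (h4 : ∀ x, σ.arr 4 x = 0) (hW : k * k < 2 ^ W)
    (hW3 : 3 ^ k < 2 ^ W) (hkW : k < W) (hmW : m < 2 ^ W) :
    Exec W (totalTime k m) mainProg σ fun τ => ∃ l : List ℕ, l.Nodup ∧ (∀ t ∈ l, t < m) ∧
      τ.reg 0 = l.length ∧ l.length ≤ 3 ^ k * 2 ^ k ∧
      (∀ (j : ℕ) (hj : j < l.length), ∀ x < k * k,
        τ.arr 2 (j * (k * k) + x) = F (l[j] * (k * k) + x)) ∧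
      ∀ t < m, ∀ w, Annihilates (2 ^ k) (cutValue F k) (fun i => degreeCode F k i k) l
        (degreeCode F k t k) w → 2 ∣ pairing (2 ^ k) (cutValue F k t) w := by
  refine Exec.seq _ _ _ (exec_powersProg h0 hkW) (fun τ₁ a₁ h₁ =>
    Exec.seq 5 _ (fun τ => τ.reg 3 = 0) (Exec.assign (by simp) (by simp)) (fun τ₂ a₂ h₂ =>
    Exec.seq ((m + 1) * (stepTime k + 50)) 5 _ (Exec.forLoop (stepTime k) m
      (fun j τ => ∃ l, Selected F k j l τ) (by decide) ?_ (Nat.size_le.2 hmW) ?_ ?_ ?_)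
    (fun τ₃ a₃ ⟨l, h₃⟩ => Exec.assign (fun hb => hb.reg 3) ?_) le_rfl) le_rfl) ?_
  · intro ρ hρ
    simp [hρ.reg 1 (by decide), a₂.reg 1 (by decide), a₁.reg 1 (by decide), h1]
  · refine ⟨[], ⟨List.nodup_nil, by simp, by simpa using h₂, by simp, ?_, by simp⟩⟩
    refine Echelon.nil _ _ _ _ fun d p q => ?_
    simp only [rows, State.setReg_arr, a₂.arr 4 (by decide), a₁.arr 4 (by decide), h4]
  · intro j hj ρ hρ h2 ⟨l, h⟩
    refine (exec_stepProg (k := k) (F := F) (l := l) ?_ h2 ?_ ?_ hF1 ?_ hW hW3 hkW (by omega)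
      h).mono le_rfl fun τ _ ⟨l', h'⟩ => ⟨l', ?_⟩
    · rw [hρ.reg 0 (by decide), a₂.reg 0 (by decide), a₁.reg 0 (by decide), h0]
    · rw [hρ.reg 5 (by decide), a₂.reg 5 (by decide), h₁.1]
    · rw [hρ.arr 1 (by decide), a₂.arr 1 (by decide), a₁.arr 1 (by decide), hF]
    · rw [hρ.arr 5 (by decide), a₂.arr 5 (by decide)]
      exact h₁.2
    · exact ⟨h'.nodup, h'.lt, by simpa using h'.length, h'.output, h'.echelon, h'.dvd⟩
  · refine Nat.mul_le_mul_left _ ?_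
    have : 2 * (Expr.reg 1).weight + (Expr.reg 1).bits + 20 = 23 := rfl
    omega
  · refine ⟨l, h₃.nodup, h₃.lt, ?_, h₃.echelon.length_le, ?_, h₃.dvd⟩
    · simpa using h₃.length
    · simpa using h₃.output
  -- The factor 2 in `totalTime` absorbs the table of powers and the loop overhead, both dominated
  -- by `stepTime k`.
  · have hst : (k + 1) * 10000 ≤ stepTime k := by
      have : 1 * 1 * ((k + 1) * 1 * 10000) ≤ stepTime k := by
        unfold stepTime
        gcongr <;> first | exact Nat.one_le_two_pow | omega
      linarith
    rw [totalTime]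
    nlinarith [Nat.zero_le (m * stepTime k), Nat.zero_le (m * k)]

/-! ### Hamiltonian cycles, degrees and cuts -/

open SimpleGraph

variable {k : ℕ}

/-- The number of vertices that `s` joins to `u`. -/
def degree (s : Finset (Sym2 (Fin k))) (u : Fin k) : ℕ :=
  (Finset.univ.filter fun v => s(u, v) ∈ s).card

theorem degree_union {s t : Finset (Sym2 (Fin k))} (h : Disjoint s t) (u : Fin k) :
    degree (s ∪ t) u = degree s u + degree t u := by
  rw [degree, degree, degree, ← Finset.card_union_of_disjoint]
  · congr 1; ext v; simp
  · rw [Finset.disjoint_filter]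
    exact fun v _ hs ht => Finset.disjoint_left.1 h hs ht

theorem reachable_induction {V : Type*} {G : SimpleGraph V} {P : V → Prop} {u v : V}
    (h : G.Reachable u v) (hu : P u) (hs : ∀ a b, G.Adj a b → P a → P b) : P v := by
  obtain ⟨w⟩ := h
  induction w with
  | nil => exact hu
  | cons hadj _ ih => exact ih (hs _ _ hadj hu)

theorem fromEdgeSet_le {G : SimpleGraph (Fin k)} {H : Finset (Sym2 (Fin k))}
    (hH : (H : Set (Sym2 (Fin k))) ⊆ G.edgeSet) :
    fromEdgeSet (H : Set (Sym2 (Fin k))) ≤ G := fun u v h => by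
  rw [fromEdgeSet_adj] at h
  exact hH h.1

theorem neighborSet_fromEdgeSet {G : SimpleGraph (Fin k)} {H : Finset (Sym2 (Fin k))}
    (hH : (H : Set (Sym2 (Fin k))) ⊆ G.edgeSet) (u : Fin k) :
    (fromEdgeSet (H : Set (Sym2 (Fin k)))).neighborSet u =
      ↑(Finset.univ.filter fun v => s(u, v) ∈ H) := by
  ext v
  simp only [mem_neighborSet, fromEdgeSet_adj, Finset.mem_coe, Finset.mem_filter,
    Finset.mem_univ, true_and, and_iff_left_iff_imp]
  exact fun h => G.ne_of_adj (hH h)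

/-- In a 2-regular graph each component is a cycle, and here there is a single component. No edge is
left out, since every vertex already has both its neighbours along the cycle. -/
theorem formsHamiltonianCycle_of_degree {G : SimpleGraph (Fin k)} {H : Finset (Sym2 (Fin k))}
    (hH : (H : Set (Sym2 (Fin k))) ⊆ G.edgeSet) (hdeg : ∀ u, degree H u = 2) (hk : 0 < k)
    (hconn : (fromEdgeSet (H : Set (Sym2 (Fin k)))).Preconnected) :
    FormsHamiltonianCycle G H := by
  classical
  set G' := fromEdgeSet (H : Set (Sym2 (Fin k))) with hG'
  have hcard : ∀ u, (G'.neighborSet u).ncard = 2 := fun u => by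
    rw [neighborSet_fromEdgeSet hH, Set.ncard_coe_finset]
    exact hdeg u
  have hcyc : G'.IsCycles := fun u _ => hcard u
  let a : Fin k := ⟨0, hk⟩
  obtain ⟨p, hp, hverts⟩ := hcyc.exists_cycle_toSubgraph_verts_eq_connectedComponentSupp
    (c := G'.connectedComponentMk a) (v := a) rfl
    (Set.nonempty_of_ncard_ne_zero (by rw [hcard]; norm_num))
  have hall : ∀ v, v ∈ p.support := fun v => by
    rw [← Walk.mem_verts_toSubgraph, hverts, ConnectedComponent.mem_supp_iff,
      ConnectedComponent.eq]
    exact hconn v a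
  refine ⟨a, p.mapLe (fromEdgeSet_le hH), ?_, ?_⟩
  · rw [Walk.isHamiltonianCycle_iff_isCycle_and_support_count_tail_eq_one]
    refine ⟨hp.mapLe _, fun v => ?_⟩
    rw [Walk.support_mapLe_eq_support]
    refine List.count_eq_one_of_mem hp.support_nodup ?_
    rcases eq_or_ne v a with rfl | hv
    · exact Walk.end_mem_tail_support hp.not_nil
    · have := hall v
      rw [← Walk.cons_tail_support] at this
      exact (List.mem_cons.1 this).resolve_left hv
  · rw [Walk.edges_mapLe_eq_edges]
    ext e
    induction e with
    | _ u v =>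
      rw [List.mem_toFinset, ← Walk.adj_toSubgraph_iff_mem_edges,
        hp.adj_toSubgraph_iff_of_isCycles hcyc (p.mem_verts_toSubgraph.2 (hall u)), hG',
        fromEdgeSet_adj]
      exact ⟨fun h => h.1, fun h => ⟨h, G.ne_of_adj (hH h)⟩⟩

theorem degree_of_formsHamiltonianCycle {G : SimpleGraph (Fin k)} {H : Finset (Sym2 (Fin k))}
    (h : FormsHamiltonianCycle G H) (u : Fin k) : degree H u = 2 := by
  obtain ⟨a, w, hw, rfl⟩ := h
  rw [← hw.isCycle.ncard_neighborSet_toSubgraph_eq_two (hw.mem_support u), degree,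
    ← Set.ncard_coe_finset]
  congr 1
  ext v
  simp [Walk.adj_toSubgraph_iff_mem_edges]

theorem three_le_of_formsHamiltonianCycle {G : SimpleGraph (Fin k)}
    {H : Finset (Sym2 (Fin k))} (h : FormsHamiltonianCycle G H) : 3 ≤ k := by
  obtain ⟨a, w, hw, rfl⟩ := h
  have := hw.isCycle.three_le_length
  rwa [hw.length_eq, Fintype.card_fin] at this

theorem preconnected_of_formsHamiltonianCycle {G : SimpleGraph (Fin k)}
    {H : Finset (Sym2 (Fin k))} (h : FormsHamiltonianCycle G H) :
    (fromEdgeSet (H : Set (Sym2 (Fin k)))).Preconnected := by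
  classical
  obtain ⟨a, w, hw, rfl⟩ := h
  have hmem : ∀ e ∈ w.edges, e ∈ (fromEdgeSet (w.edges.toFinset : Set (Sym2 (Fin k)))).edgeSet := by
    intro e he
    rw [edgeSet_fromEdgeSet]
    exact ⟨by simpa using he, G.not_isDiag_of_mem_edgeSet (w.edges_subset_edgeSet he)⟩
  have hreach : ∀ u, (fromEdgeSet (w.edges.toFinset : Set (Sym2 (Fin k)))).Reachable a u := by
    intro u
    have hu : u ∈ (w.transfer _ hmem).support := by
      rw [Walk.support_transfer]; exact hw.mem_support u
    exact ⟨(w.transfer _ hmem).takeUntil u hu⟩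
  exact fun u v => (hreach u).symm.trans (hreach v)

theorem eq_of_mem_of_degree_le_one {s : Finset (Sym2 (Fin k))} {u v x : Fin k}
    (hu : degree s u ≤ 1) (hv : s(u, v) ∈ s) (hx : s(u, x) ∈ s) : x = v :=
  Finset.card_le_one.1 hu x (by simpa using hx) v (by simpa using hv)

theorem degree_pos {s : Finset (Sym2 (Fin k))} {u v : Fin k} (hv : s(u, v) ∈ s) :
    0 < degree s u :=
  Finset.card_pos.2 ⟨v, by simpa using hv⟩

/-- An edge set with the same degrees as `s` that also makes `Y` connected can replace `s`. -/
theorem formsHamiltonianCycle_exchange {G : SimpleGraph (Fin k)} {s t Y : Finset (Sym2 (Fin k))}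
    (ht : (t : Set (Sym2 (Fin k))) ⊆ G.edgeSet) (hY : (Y : Set (Sym2 (Fin k))) ⊆ G.edgeSet)
    (hsY : Disjoint s Y) (hham : FormsHamiltonianCycle G (s ∪ Y))
    (hdeg : ∀ u, degree t u = degree s u)
    (hconn : (fromEdgeSet ((t ∪ Y : Finset _) : Set (Sym2 (Fin k)))).Preconnected) :
    Disjoint t Y ∧ FormsHamiltonianCycle G (t ∪ Y) := by
  have hsum : ∀ u, degree t u + degree Y u = 2 := fun u => by
    rw [hdeg, ← degree_union hsY, degree_of_formsHamiltonianCycle hham]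
  have hk := three_le_of_formsHamiltonianCycle hham
  -- A common edge `uv` contributes to the degree in `t` and in `Y`, which exhausts the total 2 at
  -- both ends. So `{u, v}` would be closed under adjacency, impossible in a connected graph with at
  -- least 3 vertices.
  have hdisj : Disjoint t Y := by
    rw [Finset.disjoint_left]
    intro e het heY
    induction e with
    | _ u v =>
      have hcl : ∀ a b, (fromEdgeSet ((t ∪ Y : Finset _) : Set (Sym2 (Fin k)))).Adj a b →
          (a = u ∨ a = v) → (b = u ∨ b = v) := by
        have aux : ∀ a b c, s(a, b) ∈ t → s(a, b) ∈ Y → s(a, c) ∈ t ∪ Y → c = b := by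
          intro a b c h₁ h₂ h₃
          have := hsum a
          have := degree_pos h₁
          have := degree_pos h₂
          rcases Finset.mem_union.1 h₃ with h₃ | h₃
          · exact eq_of_mem_of_degree_le_one (by omega) h₁ h₃
          · exact eq_of_mem_of_degree_le_one (by omega) h₂ h₃
        intro a b hab hauv
        rw [fromEdgeSet_adj, Finset.mem_coe] at hab
        rcases hauv with rfl | rfl
        · exact Or.inr (aux _ _ _ het heY hab.1)
        · rw [Sym2.eq_swap] at het heY
          exact Or.inl (aux _ _ _ het heY hab.1)
      have hcard : (Finset.univ : Finset (Fin k)) ⊆ {u, v} := fun x _ => by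
        simpa using reachable_induction (P := fun a => a = u ∨ a = v) (hconn u x)
          (Or.inl rfl) hcl
      have := (Finset.card_le_card hcard).trans Finset.card_le_two
      simp at this
      omega
  refine ⟨hdisj, formsHamiltonianCycle_of_degree ?_ (fun u => ?_) (by omega) hconn⟩
  · rw [Finset.coe_union]; exact Set.union_subset ht hY
  · rw [degree_union hdisj, hsum]

/-! ### Parity of the number of respected cuts. -/

/-- The sets of vertices that contain the vertex `0` and are not left by an edge of `H`, as binary
numbers. -/
noncomputable def respectedCuts (H : Finset (Sym2 (Fin k))) : Finset ℕ :=
  (Finset.range (2 ^ k)).filter fun q => q.testBit 0 = true ∧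
    ∀ u v : Fin k, s(u, v) ∈ H → q.testBit u = q.testBit v

/-- Membership spreads from vertex 0 along edges, so only the full vertex set `2 ^ k - 1` remains.
-/
theorem card_respectedCuts_of_preconnected (hk : 0 < k) {H : Finset (Sym2 (Fin k))}
    (h : (fromEdgeSet (H : Set (Sym2 (Fin k)))).Preconnected) : (respectedCuts H).card = 1 := by
  rw [Finset.card_eq_one]
  refine ⟨2 ^ k - 1, ?_⟩
  ext q
  simp only [respectedCuts, Finset.mem_filter, Finset.mem_range, Finset.mem_singleton]
  constructor
  · rintro ⟨hq, h0, hcut⟩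
    refine Nat.eq_of_testBit_eq fun u => ?_
    rw [Nat.testBit_two_pow_sub_one]
    by_cases hu : u < k
    · rw [decide_eq_true hu]
      refine reachable_induction (P := fun a : Fin k => q.testBit a = true)
        (h ⟨0, hk⟩ ⟨u, hu⟩) h0 fun a b hab ha => ?_
      rw [fromEdgeSet_adj] at hab
      rw [← hcut a b hab.1, ha]
    · rw [decide_eq_false hu]
      exact Nat.testBit_lt_two_pow (hq.trans_le (Nat.pow_le_pow_right two_pos (by omega)))
  · rintro rfl
    have : 0 < 2 ^ k := Nat.two_pow_pos k
    simp [Nat.testBit_two_pow_sub_one, hk, this]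

/-- Complementing a cut on the vertices not reachable from 0 is an involution of the respected cuts:
this mask is a union of components and omits vertex 0. It has no fixed point because the mask is not
empty. -/
theorem even_card_respectedCuts (hk : 0 < k) {H : Finset (Sym2 (Fin k))}
    (h : ¬ (fromEdgeSet (H : Set (Sym2 (Fin k)))).Preconnected) : 2 ∣ (respectedCuts H).card := by
  classical
  set G := fromEdgeSet (H : Set (Sym2 (Fin k))) with hG
  let a : Fin k := ⟨0, hk⟩
  obtain ⟨b, hb⟩ : ∃ b, ¬ G.Reachable a b := by
    by_contra! hall
    exact h fun u v => (hall u).symm.trans (hall v)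
  let mask := Nat.ofBits fun u : Fin k => decide (¬ G.Reachable a u)
  have hmask : ∀ u : Fin k, mask.testBit u = decide (¬ G.Reachable a u) := fun u =>
    Nat.testBit_ofBits_lt _ _ u.2
  have hsum : ∑ _q ∈ respectedCuts H, (1 : ZMod 2) = 0 := by
    refine Finset.sum_involution (fun q _ => q ^^^ mask) (fun _ _ => by decide) ?_ ?_ ?_
    · intro q _ _ heq
      have := congrArg (fun n => n.testBit b) heq
      simp [Nat.testBit_xor, hmask, hb] at this
    · intro q hq
      simp only [respectedCuts, Finset.mem_filter, Finset.mem_range] at hq ⊢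
      obtain ⟨hlt, h0, hcut⟩ := hq
      refine ⟨Nat.xor_lt_two_pow hlt (Nat.ofBits_lt_two_pow _), ?_, fun u v huv => ?_⟩
      · have : mask.testBit 0 = false := by
          rw [show (0 : ℕ) = (a : ℕ) from rfl, hmask]; simp
        rw [Nat.testBit_xor, h0, this]; rfl
      · rw [Nat.testBit_xor, Nat.testBit_xor, hcut u v huv, hmask, hmask]
        congr 2
        rw [eq_iff_iff, not_iff_not]
        rcases eq_or_ne u v with rfl | hne
        · rfl
        · have hadj : G.Adj u v := by rw [hG, fromEdgeSet_adj]; exact ⟨huv, hne⟩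
          exact ⟨fun h => h.trans hadj.reachable, fun h => h.trans hadj.symm.reachable⟩
    · intro q _
      simp
  rw [Finset.sum_const, nsmul_one] at hsum
  exact (ZMod.natCast_eq_zero_iff _ _).1 hsum

/-! ### What the program computes, in terms of the input -/

theorem graphArray_le_one (G : SimpleGraph (Fin k)) (x : ℕ) : graphArray G x ≤ 1 := by
  unfold graphArray; split_ifs <;> simp

theorem familyArray_le_one (L : List (Finset (Sym2 (Fin k)))) (x : ℕ) : familyArray L x ≤ 1 := by
  unfold familyArray; split_ifs <;> simp

theorem familyArray_apply (L : List (Finset (Sym2 (Fin k)))) {i : ℕ} (hi : i < L.length)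
    (u v : Fin k) : familyArray L ((i * k + u) * k + v) = if s(u, v) ∈ L[i] then 1 else 0 := by
  unfold familyArray
  congr 1
  refine propext ⟨?_, fun h => ⟨⟨i, hi⟩, u, v, rfl, h⟩⟩
  rintro ⟨j, u', v', h, hmem⟩
  obtain ⟨rfl, hu, hv⟩ := (address_injective u.2 v.2 u'.2 v'.2).1 h
  rwa [Fin.ext hu, Fin.ext hv]

theorem rowSum_familyArray (L : List (Finset (Sym2 (Fin k)))) {i : ℕ} (hi : i < L.length)
    (u : Fin k) : rowSum (familyArray L) k i u = degree L[i] u := by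
  rw [rowSum, Finset.sum_range, degree, Finset.card_filter]
  exact Finset.sum_congr rfl fun v _ => familyArray_apply L hi u v

/-- With truncated subtraction, `1 - d / 3` is 1 for `d ≤ 2` and 0 otherwise. -/
theorem degreeTest_ne_zero_iff {F : ℕ → ℕ} {i n : ℕ} :
    degreeTest F k i n ≠ 0 ↔ ∀ u < n, rowSum F k i u ≤ 2 := by
  rw [degreeTest, Finset.prod_ne_zero_iff]
  simp only [Finset.mem_range]
  refine forall₂_congr fun u _ => ?_
  omega

/-- Degrees at most 2 are genuine base-3 digits, which the code determines. -/
theorem rowSum_eq_of_degreeCode_eq {F : ℕ → ℕ} {i j n : ℕ} (hi : ∀ u < n, rowSum F k i u ≤ 2)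
    (hj : ∀ u < n, rowSum F k j u ≤ 2) (h : degreeCode F k i n = degreeCode F k j n) :
    ∀ u < n, rowSum F k i u = rowSum F k j u := by
  induction n with
  | zero => simp
  | succ n ih =>
    have h1 := hi n n.lt_succ_self
    have h2 := hj n n.lt_succ_self
    rw [degreeCode, degreeCode] at h
    intro u hu
    rcases Nat.lt_succ_iff_lt_or_eq.1 hu with hu | rfl
    · exact ih (fun u hu => hi u (by omega)) (fun u hu => hj u (by omega)) (by omega) u hu
    · omega

open Classical in
/-- Whether no edge of `H` leaves the vertex set with binary number `q`. -/
noncomputable def cutIndicator (H : Finset (Sym2 (Fin k))) (q : ℕ) : ℕ :=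
  if ∀ u v : Fin k, s(u, v) ∈ H → q.testBit u = q.testBit v then 1 else 0

theorem testBit_eq_iff (q u v : ℕ) :
    q.testBit u = q.testBit v ↔ (q / 2 ^ u + q / 2 ^ v) % 2 = 0 := by
  rw [Nat.testBit_eq_decide_div_mod_eq, Nat.testBit_eq_decide_div_mod_eq, decide_eq_decide]
  omega

theorem cutValue_familyArray (L : List (Finset (Sym2 (Fin k)))) {i : ℕ} (hi : i < L.length)
    (q : ℕ) : cutValue (familyArray L) k i q =
      degreeTest (familyArray L) k i k * (q % 2) * cutIndicator L[i] q := by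
  rw [cutValue, cutIndicator]
  congr 1
  split_ifs with h
  · refine Finset.prod_eq_one fun x hx => ?_
    have hx := Finset.mem_range.1 hx
    have hk : 0 < k := Nat.pos_of_ne_zero fun h => by simp [h] at hx
    have hu : x / k < k := Nat.div_lt_of_lt_mul hx
    have hv : x % k < k := Nat.mod_lt x hk
    have happ := familyArray_apply L hi ⟨x / k, hu⟩ ⟨x % k, hv⟩
    have haddr : (i * k + x / k) * k + x % k = i * (k * k) + x := by
      conv_rhs => rw [← Nat.div_add_mod x k]
      ring
    rw [haddr] at happ
    rw [happ]
    split_ifs with hmem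
    · rw [(testBit_eq_iff _ _ _).1 (h _ _ hmem), mul_zero, Nat.sub_zero]
    · simp
  · push Not at h
    obtain ⟨u, v, hmem, hne⟩ := h
    have hk : 0 < k := u.pos
    refine Finset.prod_eq_zero (i := u.1 * k + v.1) (Finset.mem_range.2 ?_) ?_
    · have := u.2
      have := v.2
      nlinarith
    · have hdiv : (u.1 * k + v.1) / k = u := by
        rw [add_comm, Nat.add_mul_div_right _ _ hk, Nat.div_eq_of_lt v.2, zero_add]
      have hmod : (u.1 * k + v.1) % k = v := by
        rw [Nat.mul_add_mod', Nat.mod_eq_of_lt v.2]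
      have haddr : i * (k * k) + (u.1 * k + v.1) = (i * k + u) * k + v := by ring
      have := mt (testBit_eq_iff q u v).2 hne
      rw [hdiv, hmod, haddr, familyArray_apply L hi, if_pos hmem]
      omega

/-- A cut is respected by a union exactly when both parts respect it, so the product of indicators
counts common cuts; the factor `q % 2` puts vertex 0 inside. -/
theorem pairing_cutValue (L : List (Finset (Sym2 (Fin k)))) {i : ℕ} (hi : i < L.length)
    (Y : Finset (Sym2 (Fin k))) :
    pairing (2 ^ k) (cutValue (familyArray L) k i) (cutIndicator Y) =
      degreeTest (familyArray L) k i k * (respectedCuts (L[i] ∪ Y)).card := by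
  classical
  rw [pairing, respectedCuts, Finset.card_filter, Finset.mul_sum]
  refine Finset.sum_congr rfl fun q _ => ?_
  rw [cutValue_familyArray L hi, mul_assoc, mul_assoc]
  congr 1
  have h0 : q.testBit 0 = true ↔ q % 2 = 1 := by
    rw [Nat.testBit_zero, decide_eq_true_iff]
  have hunion : (∀ u v : Fin k, s(u, v) ∈ L[i] ∪ Y → q.testBit u = q.testBit v) ↔
      (∀ u v : Fin k, s(u, v) ∈ L[i] → q.testBit u = q.testBit v) ∧
        ∀ u v : Fin k, s(u, v) ∈ Y → q.testBit u = q.testBit v := by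
    simp only [Finset.mem_union, or_imp, forall_and]
  simp only [cutIndicator, h0, hunion]
  rcases Nat.mod_two_eq_zero_or_one q with h | h
  · simp [h]
  · clear h0 hunion
    simp only [h, one_mul, true_and]
    split_ifs <;> first | rfl | (exfalso; tauto)

/-- If the cut vectors of the selected edge sets span those of all edge sets with the same degrees,
then the selected edge sets represent all edge sets. -/
theorem exists_mem_of_dvd {G : SimpleGraph (Fin k)} {L : List (Finset (Sym2 (Fin k)))}
    (hL : ∀ s ∈ L, (s : Set (Sym2 (Fin k))) ⊆ G.edgeSet) {l : List ℕ}
    (hl : ∀ t ∈ l, t < L.length)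
    (hdvd : ∀ t < L.length, ∀ w, Annihilates (2 ^ k) (cutValue (familyArray L) k)
      (fun i => degreeCode (familyArray L) k i k) l (degreeCode (familyArray L) k t k) w →
        2 ∣ pairing (2 ^ k) (cutValue (familyArray L) k t) w)
    {Y : Finset (Sym2 (Fin k))} (hY : (Y : Set (Sym2 (Fin k))) ⊆ G.edgeSet)
    {i : ℕ} (hi : i < L.length) (hdisj : Disjoint L[i] Y)
    (hham : FormsHamiltonianCycle G (L[i] ∪ Y)) :
    ∃ (t : ℕ) (_ : t ∈ l) (ht : t < L.length),
      Disjoint L[t] Y ∧ FormsHamiltonianCycle G (L[t] ∪ Y) := by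
  have hk : 0 < k := by have := three_le_of_formsHamiltonianCycle hham; omega
  have hi2 : ∀ u < k, rowSum (familyArray L) k i u ≤ 2 := fun u hu => by
    rw [rowSum_familyArray L hi ⟨u, hu⟩, ← degree_of_formsHamiltonianCycle hham ⟨u, hu⟩,
      degree_union hdisj]
    omega
  have hodd : ¬ 2 ∣ pairing (2 ^ k) (cutValue (familyArray L) k i) (cutIndicator Y) := by
    have h1 := degreeTest_ne_zero_iff.2 hi2
    have h2 := degreeTest_le_one (familyArray L) k i k
    rw [pairing_cutValue L hi, card_respectedCuts_of_preconnected hk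
      (preconnected_of_formsHamiltonianCycle hham)]
    omega
  -- The cut indicator of `Y` is the test vector: if it annihilated all selected vectors with the
  -- code of `i`, its pairing with `i` would be even.
  have hnot := mt (hdvd i hi (cutIndicator Y)) hodd
  unfold Annihilates at hnot
  push Not at hnot
  obtain ⟨t, htl, hcode, hndvd⟩ := hnot
  have ht := hl t htl
  rw [pairing_cutValue L ht] at hndvd
  -- An odd pairing means that `t` passed the degree test, without which equal codes would give only
  -- degrees equal modulo 3.
  have ht2 : ∀ u < k, rowSum (familyArray L) k t u ≤ 2 :=
    degreeTest_ne_zero_iff.1 fun h => hndvd (by rw [h, zero_mul]; exact dvd_zero 2)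
  refine ⟨t, htl, ht, formsHamiltonianCycle_exchange (hL _ (List.getElem_mem ht)) hY hdisj hham
    (fun u => ?_) ?_⟩
  · rw [← rowSum_familyArray L ht, ← rowSum_familyArray L hi]
    exact rowSum_eq_of_degreeCode_eq ht2 hi2 hcode u u.2
  · by_contra hconn
    exact hndvd ((even_card_respectedCuts hk hconn).mul_left _)

/-! ### Word length, output format and total time. -/

/-- This makes the word length needed to count edge sets polynomial in `k`, whatever the size of the
family. -/
theorem length_le_two_pow {L : List (Finset (Sym2 (Fin k)))} (hL : L.Nodup) :
    L.length ≤ 2 ^ (k * k) := by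
  classical
  rw [← List.toFinset_card_of_nodup hL]
  refine (Finset.card_le_univ _).trans ?_
  rw [Fintype.card_finset]
  refine Nat.pow_le_pow_right two_pos ?_
  rw [Sym2.card, Fintype.card_fin, Nat.choose_two_right]
  refine Nat.div_le_of_le_mul ?_
  rw [Nat.add_sub_cancel]
  rcases k.eq_zero_or_pos with rfl | hk
  · simp
  · nlinarith

theorem bounded_inputState (G : SimpleGraph (Fin k)) (L : List (Finset (Sym2 (Fin k)))) {W : ℕ}
    (hk : k < 2 ^ W) (hL : L.length < 2 ^ W) (hone : 1 < 2 ^ W) :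
    Bounded W (inputState G L) where
  reg r := by
    rw [Nat.size_le]
    simp only [inputState]
    split_ifs <;> omega
  arr a x := by
    rw [Nat.size_le]
    simp only [inputState]
    have := graphArray_le_one G x
    have := familyArray_le_one L x
    split_ifs
    exacts [by omega, by omega, by simp]

theorem outputs_of_indices {L : List (Finset (Sym2 (Fin k)))} (hL : L.Nodup) {l : List ℕ}
    (hnodup : l.Nodup) (hl : ∀ t ∈ l, t < L.length) {τ : State} (h0 : τ.reg 0 = l.length)
    (hout : ∀ (j : ℕ) (hj : j < l.length), ∀ x < k * k,
      τ.arr 2 (j * (k * k) + x) = familyArray L (l[j] * (k * k) + x)) :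
    Outputs τ (l.pmap (fun t ht => L[t]'ht) hl).toFinset := by
  set L' := l.pmap (fun t ht => L[t]'ht) hl with hL'
  have hlen : L'.length = l.length := by rw [hL', List.length_pmap]
  have hnodup' : L'.Nodup :=
    hnodup.pmap fun a ha b hb h => (List.Nodup.getElem_inj_iff hL).1 h
  refine ⟨L', ⟨hnodup', by congr⟩, by rw [h0, hlen], fun x hx => ?_⟩
  rcases k.eq_zero_or_pos with rfl | hk
  · simp at hx
  have hkk : 0 < k * k := Nat.mul_pos hk hk
  have hj : x / (k * k) < L'.length := Nat.div_lt_of_lt_mul (by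
    rw [mul_comm, ← mul_assoc]; exact hx)
  have hy : x % (k * k) < k * k := Nat.mod_lt x hkk
  have hxe : x = x / (k * k) * (k * k) + x % (k * k) := (Nat.div_add_mod' x (k * k)).symm
  generalize x / (k * k) = j at *
  generalize x % (k * k) = y at *
  subst hxe
  rw [hout j (hlen ▸ hj) y hy]
  have hu : y / k < k := Nat.div_lt_of_lt_mul hy
  have hv : y % k < k := Nat.mod_lt y hk
  have haddr : ∀ i, i * (k * k) + y =
      (i * k + (⟨y / k, hu⟩ : Fin k)) * k + (⟨y % k, hv⟩ : Fin k) := by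
    intro i
    conv_lhs => rw [← Nat.div_add_mod y k]
    ring
  rw [haddr, haddr, familyArray_apply L (hl _ (List.getElem_mem _)), familyArray_apply L' hj]
  simp only [hL', List.getElem_pmap]

theorem totalTime_le (k m : ℕ) :
    totalTime k m * (k * k + 2 * k + 3 + 1) ≤ 160000 * (k + 1) ^ 4 * (max 1 m * 12 ^ k) := by
  have hm : m + 1 ≤ 2 * max 1 m := by omega
  have h4 : 2 ^ k * 2 ^ k ≤ 12 ^ k := by
    rw [← mul_pow]; exact Nat.pow_le_pow_left (by norm_num) k
  rw [totalTime, stepTime]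
  -- The last factor is `W + 1` for the word length of the main theorem, at most `4 * (k + 1) ^ 2`.
  calc (m + 1) * (2 ^ k * 2 ^ k * ((k + 1) * (k + 1) * 10000) * 2) * (k * k + 2 * k + 3 + 1)
      ≤ (2 * max 1 m) * (12 ^ k * ((k + 1) * (k + 1) * 10000) * 2) * (4 * ((k + 1) * (k + 1))) :=
        Nat.mul_le_mul (Nat.mul_le_mul hm (by gcongr)) (by nlinarith)
    _ = 160000 * (k + 1) ^ 4 * (max 1 m * 12 ^ k) := by ring

end RepresentativeFamily

open RepresentativeFamily in
theorem mainTheorem5 :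
    ∃ (P : RAM.Prog) (C c : ℕ),
      ∀ (k : ℕ) (G : SimpleGraph (Fin k)) (S : Finset (Finset (Sym2 (Fin k)))),
        (∀ s ∈ S, (s : Set (Sym2 (Fin k))) ⊆ G.edgeSet) →
        ∀ L : List (Finset (Sym2 (Fin k))), IsListing L S →
          ∃ (t : ℕ) (τ : RAM.State) (T : Finset (Finset (Sym2 (Fin k)))),
            RAM.Run P (inputState G L) t τ ∧
            t ≤ C * (k + 1) ^ c * (max 1 S.card * 12 ^ k) ∧
            Outputs τ T ∧
            T ⊆ S ∧
            T.card ≤ 6 ^ k ∧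
            ∀ Y : Finset (Sym2 (Fin k)), (Y : Set (Sym2 (Fin k))) ⊆ G.edgeSet →
              (∃ s ∈ S, Disjoint s Y ∧ FormsHamiltonianCycle G (s ∪ Y)) →
              ∃ s' ∈ T, Disjoint s' Y ∧ FormsHamiltonianCycle G (s' ∪ Y) := by
  refine ⟨mainProg, 160000, 4, fun k G S hS L ⟨hL, hLS⟩ => ?_⟩
  subst hLS
  have hmem : ∀ s ∈ L, (s : Set (Sym2 (Fin k))) ⊆ G.edgeSet := fun s hs => hS s (by simpa using hs)
  -- The term `k * k` accommodates the number of edge sets and `2 * k` the degree codes, by `3 ^ k ≤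
  -- 4 ^ k`. Array addresses are never stored and may be longer; `Expr.cost_le` pays for them.
  set W := k * k + 2 * k + 3 with hW
  have hmW : L.length < 2 ^ W := (length_le_two_pow hL).trans_lt
    (Nat.pow_lt_pow_right (by norm_num) (by omega))
  have hkkW : k * k < 2 ^ W := (by omega : k * k ≤ W).trans_lt Nat.lt_two_pow_self
  have hkW : k < W := by rw [hW]; nlinarith
  have h3W : 3 ^ k < 2 ^ W := by
    calc 3 ^ k ≤ 4 ^ k := Nat.pow_le_pow_left (by norm_num) k
      _ = 2 ^ (2 * k) := by rw [pow_mul]; norm_num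
      _ < 2 ^ W := Nat.pow_lt_pow_right (by norm_num) (by omega)
  obtain ⟨t, τ, hrun, ht, -, -, l, hnodup, hl, h0, hcard, hout, hdvd⟩ :=
    exec_mainProg (W := W) (k := k) (m := L.length) (F := familyArray L)
      (σ := inputState G L) rfl rfl rfl (familyArray_le_one L) (fun _ => rfl) hkkW h3W hkW hmW
      (bounded_inputState G L (hkW.trans Nat.lt_two_pow_self) hmW
        (Nat.one_lt_two_pow (by omega)))
  have hsub : ∀ s ∈ l.pmap (fun t ht => L[t]'ht) hl, s ∈ L := by
    intro s hs
    obtain ⟨i, hi, rfl⟩ := List.mem_pmap.1 hs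
    exact List.getElem_mem _
  refine ⟨t, τ, (l.pmap (fun t ht => L[t]'ht) hl).toFinset, hrun, ?_,
    outputs_of_indices hL hnodup hl h0 hout, fun s hs => ?_, ?_, ?_⟩
  · rw [List.toFinset_card_of_nodup hL]
    exact ht.trans (totalTime_le k L.length)
  · exact List.mem_toFinset.2 (hsub s (List.mem_toFinset.1 hs))
  · refine (List.toFinset_card_le _).trans ?_
    rw [List.length_pmap, show 6 = 3 * 2 from rfl, mul_pow]
    exact hcard
  · rintro Y hY ⟨s, hs, hdisj, hham⟩
    obtain ⟨i, hi, rfl⟩ := List.getElem_of_mem (List.mem_toFinset.1 hs)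
    obtain ⟨j, hjl, hj, hd, hh⟩ := exists_mem_of_dvd hmem hl hdvd hY hi hdisj hham
    exact ⟨L[j], List.mem_toFinset.2 (List.mem_pmap.2 ⟨j, hjl, rfl⟩), hd, hh⟩
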